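/- **Theorem 3.12.** *Setting.* Let $C_2=\{e,\sigma\}$, and let $\mathbb{R}^{p,q}=\mathbb{R}^p\oplus\mathbb{R}^{q\delta}$ be the orthogonal $C_2$-representation on which $\sigma$ acts by $+1$ on the first $p$ coordinates and by $-1$ on the last $q$. All spaces are compactly generated weak Hausdorff; products and mapping spaces are formed in that category. Let $C_2\mathrm{Top}_*$ be the category of pointed $C_2$-spaces; a map $X\to Y$ in it is a weak equivalence if $X^H\to Y^H$ is a weak homotopy equivalence for both subgroups $H\le C_2$. Let $C_2\mathcal{J}_{0,0}$ be the $C_2\mathrm{Top}_*$-enriched category whose objects are the finite-dimensional subrepresentations of $\bigoplus_{i=1}^{\infty}\mathbb{R}[C_2]$ with the inherited inner product, and whose morphism space from $U$ to $V$ is $\mathcal{L}(U,V)_+$, where $\mathcal{L}(U,V)$ is the space of all linear isometries $U\to V$ with the conjugation action $\sigma*f=\sigma f\sigma$. Let $C_2\mathcal{E}_{0,0}$ be the category of $C_2\mathrm{Top}_*$-enriched functors $C_2\mathcal{J}_{0,0}\to C_2\mathrm{Top}_*$ and $C_2$-equivariant natural transformations. For $p,q\ge 0$ and $V,W\in C_2\mathcal{J}_{0,0}$,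 let $$S\gamma_{p,q}(V,W)=\{(f,x): f\in\mathcal{L}(V,W),\ x\in\mathbb{R}^{p,q}\otimes f(V)^{\perp},\ \|x\|=1\},\qquad \sigma(f,x)=(\sigma f\sigma,\sigma x),$$ with $\sigma$ acting diagonally on $\mathbb{R}^{p,q}\otimes W$. For $E\in C_2\mathcal{E}_{0,0}$ let $\tau_{p,q}E\in C_2\mathcal{E}_{0,0}$ be the functor $$\tau_{p,q}E(V)=\mathrm{Nat}\big(S\gamma_{p,q}(V,-)_+,E\big),$$ the space of all (not necessarily $C_2$-equivariant) natural transformations, with $C_2$ acting by conjugation and based at the constant one. Let $\rho_{p,q}E:E\to\tau_{p,q}E$ be the morphism that sends $x\in E(V)$ to the natural transformation $(f,y)\mapsto E(f)(x)$. The functor $E$ is called *strongly $(p,q)$-polynomial* if $\rho_{p,q}E(V)$ is a weak equivalence in $C_2\mathrm{Top}_*$ for every $V\in C_2\mathcal{J}_{0,0}$. Let $$T_{p,q}E=\mathrm{hocolim}\big(E\xrightarrow{\ \rho_{p,q}\ }\tau_{p,q}E\xrightarrow{\ \rho_{p,q}\ }\tau_{p,q}^2E\xrightarrow{\ \rho_{p,q}\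 }\cdots\big),$$ formed objectwise as a mapping telescope, where the $k$-th map is $\rho_{p,q}(\tau_{p,q}^kE)$. *Claim.* For every $E\in C_2\mathcal{E}_{0,0}$ and all integers $p,q\ge 0$, the functor $T_{p,q}E$ is strongly $(p,q)$-polynomial. -/

import Mathlib

universe u

noncomputable section

namespace C2Calculus

open Topology unitInterval

section PointSet

/-- A space is *weak Hausdorff* if every continuous image in it of a compact Hausdorff space is
closed. -/
class WeaklyHausdorff (X : Type u) [TopologicalSpace X] : Prop where
  isClosed_range : ∀ (K : Type u) [TopologicalSpace K] [CompactSpace K] [T2Space K] (f : K → X),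
    Continuous f → IsClosed (Set.range f)

/-- In a weak Hausdorff space, the coincidence set of two maps from a compact Hausdorff space is
closed. -/
theorem isClosed_eq_of_wh {X : Type u} [TopologicalSpace X] [WeaklyHausdorff X]
    {K : Type u} [TopologicalSpace K] [CompactSpace K] [T2Space K] {f g : K → X}
    (hf : Continuous f) (hg : Continuous g) : IsClosed {k | f k = g k} := by
  have himg : ∀ (h : K → X), Continuous h → ∀ C : Set K, IsClosed C → IsClosed (h '' C) := by
    intro h hh C hC
    have : CompactSpace C := isCompact_iff_compactSpace.1 hC.isCompact
    have := WeaklyHausdorff.isClosed_range C (fun c : C => h c) (by fun_prop)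
    rwa [show Set.range (fun c : C => h c) = h '' C by ext; simp] at this
  have hpt : ∀ x : X, IsClosed ({x} : Set X) := by
    intro x
    have := WeaklyHausdorff.isClosed_range PUnit.{u + 1} (fun _ => x) continuous_const
    rwa [Set.range_const] at this
  rw [← isOpen_compl_iff, isOpen_iff_mem_nhds]
  intro k hk
  have hne : f k ≠ g k := hk
  -- the two maps together, on the disjoint union
  have hw : ∀ C : Set K, IsClosed C → IsClosed (f '' C ∪ g '' C) := fun C hC =>
    (himg f hf C hC).union (himg g hg C hC)
  let w : K ⊕ K → X := Sum.elim f g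
  have hwc : Continuous w := hf.sumElim hg
  have hwi : ∀ C : Set (K ⊕ K), IsClosed C → IsClosed (w '' C) := by
    intro C hC
    have : CompactSpace C := isCompact_iff_compactSpace.1 hC.isCompact
    have := WeaklyHausdorff.isClosed_range C (fun c : C => w c) (by fun_prop)
    rwa [show Set.range (fun c : C => w c) = w '' C by ext; simp] at this
  obtain ⟨O₁, O₂, ho₁, ho₂, h₁, h₂, hd⟩ := normal_separation ((hpt (f k)).preimage hwc)
    ((hpt (g k)).preimage hwc) (by
      rw [Set.disjoint_left]
      intro z h1 h2
      exact hne ((h1 : w z = f k).symm.trans h2))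
  have c₁ := hwi _ ho₁.isClosed_compl
  have c₂ := hwi _ ho₂.isClosed_compl
  have m₁ : f ⁻¹' (w '' O₁ᶜ)ᶜ ∈ 𝓝 k := (c₁.isOpen_compl.preimage hf).mem_nhds (by
    rintro ⟨z, hz, e⟩; exact hz (h₁ e))
  have m₂ : g ⁻¹' (w '' O₂ᶜ)ᶜ ∈ 𝓝 k := (c₂.isOpen_compl.preimage hg).mem_nhds (by
    rintro ⟨z, hz, e⟩; exact hz (h₂ e))
  filter_upwards [m₁, m₂] with l hl₁ hl₂ he
  have a₁ : Sum.inl l ∈ O₁ := by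
    by_contra hc; exact hl₁ ⟨Sum.inl l, hc, rfl⟩
  have a₂ : Sum.inl l ∈ O₂ := by
    by_contra hc; exact hl₂ ⟨Sum.inl l, hc, (he : f l = g l)⟩
  exact Set.disjoint_left.1 hd a₁ a₂

/-- For compactly generated spaces the converse holds. -/
theorem wh_of_isClosed_eq {X : Type u} [TopologicalSpace X] [CompactlyGeneratedSpace X]
    (h : ∀ (K : Type u) [TopologicalSpace K] [CompactSpace K] [T2Space K] (f g : K → X),
      Continuous f → Continuous g → IsClosed {k | f k = g k}) : WeaklyHausdorff X where
  isClosed_range K _ _ _ f hf := by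
    refine CompactlyGeneratedSpace.isClosed' fun L _ _ _ g hg => ?_
    have hc := h (L × K) (fun z => g z.1) (fun z => f z.2) (by fun_prop) (by fun_prop)
    have := isClosedMap_fst_of_compactSpace (X := L) (Y := K) _ hc
    convert this using 1
    ext l
    simp [eq_comm]

theorem wh_of_injective {X Y : Type u} [TopologicalSpace X] [TopologicalSpace Y]
    [CompactlyGeneratedSpace X] (i : X → Y) (hi : Continuous i) (hinj : Function.Injective i)
    (h : ∀ (K : Type u) [TopologicalSpace K] [CompactSpace K] [T2Space K] (f g : K → Y),
      Continuous f → Continuous g → IsClosed {k | f k = g k}) : WeaklyHausdorff X :=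
  wh_of_isClosed_eq fun K _ _ _ f g hf hg => by
    simpa [hinj.eq_iff] using h K (i ∘ f) (i ∘ g) (hi.comp hf) (hi.comp hg)

/-- The product of a compactly generated space with a compact Hausdorff space is compactly
generated. -/
theorem compactlyGenerated_prod (L : Type) [TopologicalSpace L] [CompactSpace L] [T2Space L]
    (X : Type u) [TopologicalSpace X] [CompactlyGeneratedSpace X] :
    CompactlyGeneratedSpace (L × X) := by
  refine compactlyGeneratedSpace_of_isOpen fun s hs => ?_
  have slice : ∀ x : X, Continuous fun l : L => ((l, x) ∈ s : Prop) := by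
    intro x
    have := hs (ULift.{u} L) (fun l => (l.down, x)) (by fun_prop)
    exact (continuous_Prop.2 this).comp continuous_uliftUp
  let F : X → C(L, Prop) := fun x => ⟨_, slice x⟩
  have hF : Continuous F := by
    refine continuous_from_compactlyGeneratedSpace F fun K _ _ _ g hg => ?_
    refine ContinuousMap.continuous_of_continuous_uncurry _ ?_
    have := hs (K × ULift.{u} L) (fun z => (z.2.down, g z.1)) (by fun_prop)
    exact (continuous_Prop.2 this).comp
      (f := fun z : K × L => ((z.1, ULift.up z.2) : K × ULift.{u} L))
      (continuous_fst.prodMk (continuous_uliftUp.comp continuous_snd))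
  have h2 : Continuous fun z : L × X => F z.2 z.1 := by fun_prop
  exact continuous_Prop.1 h2

/-- The `k`-ification of a space `X`: the same points, with the topology coinduced by all
continuous maps from compact Hausdorff spaces to `X`. -/
@[ext]
structure Kify (X : Type u) : Type u where
  /-- A point of the space, seen in its `k`-ification. -/
  mk ::
  /-- The underlying point. -/
  val : X

instance (X : Type u) [TopologicalSpace X] : TopologicalSpace (Kify X) :=
  TopologicalSpace.coinduced Kify.mk (TopologicalSpace.compactlyGenerated.{u} X)

theorem Kify.isOpen_iff {X : Type u} [TopologicalSpace X] {s : Set (Kify X)} :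
    IsOpen s ↔ ∀ (K : CompHaus.{u}) (f : C(K, X)), IsOpen ((fun k => Kify.mk (f k)) ⁻¹' s) := by
  rw [isOpen_coinduced, TopologicalSpace.compactlyGenerated, isOpen_coinduced, isOpen_sigma_iff]
  exact ⟨fun h K f => h ⟨K, f⟩, fun h ⟨K, f⟩ => h K f⟩

theorem Kify.continuous_val {X : Type u} [TopologicalSpace X] :
    Continuous (Kify.val : Kify X → X) :=
  continuous_def.2 fun _ hs => Kify.isOpen_iff.2 fun _ f => hs.preimage f.continuous

theorem Kify.continuous_mk_comp_compact {X : Type u} [TopologicalSpace X] {K : Type u}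
    [TopologicalSpace K] [CompactSpace K] [T2Space K] {f : K → X} (hf : Continuous f) :
    Continuous fun k => Kify.mk (f k) :=
  continuous_def.2 fun _ hs => Kify.isOpen_iff.1 hs (CompHaus.of K) ⟨f, hf⟩

theorem Kify.continuous_mk_comp {X Y : Type u} [TopologicalSpace X] [TopologicalSpace Y]
    [CompactlyGeneratedSpace Y] {f : Y → X} (hf : Continuous f) :
    Continuous fun y => Kify.mk (f y) :=
  continuous_from_compactlyGeneratedSpace _ fun _ _ _ _ _ hg =>
    Kify.continuous_mk_comp_compact (hf.comp hg)

instance (X : Type u) [TopologicalSpace X] : CompactlyGeneratedSpace (Kify X) :=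
  compactlyGeneratedSpace_of_isOpen fun _ hs => Kify.isOpen_iff.2 fun K f =>
    hs K (fun k => Kify.mk (f k)) (Kify.continuous_mk_comp_compact f.continuous)

end PointSet

section WeakEquivalence

variable {X Y : Type u} [TopologicalSpace X] [TopologicalSpace Y]

/-- The map induced by a continuous map on sets of path components. -/
def pi0Map (f : C(X, Y)) : ZerothHomotopy X → ZerothHomotopy Y :=
  Quotient.map f fun _ _ ⟨γ⟩ => ⟨γ.map f.continuous⟩

/-- The map `π_n(X, x) → π_n(Y, f x)` induced by a continuous map `f`. -/
def piMap (f : C(X, Y)) (n : ℕ) (x : X) :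
    HomotopyGroup (Fin n) X x → HomotopyGroup (Fin n) Y (f x) :=
  Quotient.map (fun γ => ⟨f.comp γ.1, fun y hy => congrArg f (γ.2 y hy)⟩)
    fun _ _ h => h.comp_continuousMap f

/-- Weak homotopy equivalences: bijections on path components and isomorphisms on all homotopy
groups at all basepoints. -/
def IsWeakHomotopyEquiv (f : C(X, Y)) : Prop :=
  Function.Bijective (pi0Map f) ∧ ∀ (n : ℕ) (x : X), Function.Bijective (piMap f n x)

end WeakEquivalence

section LinearIsometries

variable {E F G : Type*} [NormedAddCommGroup E] [NormedSpace ℝ E] [NormedAddCommGroup F]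
  [NormedSpace ℝ F] [NormedAddCommGroup G] [NormedSpace ℝ G]

/-- Spaces of linear isometries carry the topology of the operator norm (for finite-dimensional
spaces, the usual topology of a Stiefel manifold). -/
instance : TopologicalSpace (E →ₗᵢ[ℝ] F) :=
  TopologicalSpace.induced LinearIsometry.toContinuousLinearMap inferInstance

theorem isEmbedding_toCLM :
    IsEmbedding (LinearIsometry.toContinuousLinearMap : (E →ₗᵢ[ℝ] F) → (E →L[ℝ] F)) :=
  ⟨⟨rfl⟩, LinearIsometry.toContinuousLinearMap_injective⟩

instance : T2Space (E →ₗᵢ[ℝ] F) := isEmbedding_toCLM.t2Space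

theorem continuous_isometry_apply : Continuous fun z : (E →ₗᵢ[ℝ] F) × E => z.1 z.2 := by
  have h : Continuous fun z : (E →ₗᵢ[ℝ] F) × E => z.1.toContinuousLinearMap z.2 :=
    (isEmbedding_toCLM.continuous.comp continuous_fst).clm_apply continuous_snd
  exact h

theorem continuous_isometry_comp :
    Continuous fun z : (F →ₗᵢ[ℝ] G) × (E →ₗᵢ[ℝ] F) => z.1.comp z.2 := by
  rw [isEmbedding_toCLM.continuous_iff]
  have h : Continuous fun z : (F →ₗᵢ[ℝ] G) × (E →ₗᵢ[ℝ] F) =>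
      z.1.toContinuousLinearMap.comp z.2.toContinuousLinearMap :=
    (isEmbedding_toCLM.continuous.comp continuous_fst).clm_comp
      (isEmbedding_toCLM.continuous.comp continuous_snd)
  exact h

instance [FiniteDimensional ℝ E] [FiniteDimensional ℝ F] : CompactSpace (E →ₗᵢ[ℝ] F) := by
  have hr : Set.range (LinearIsometry.toContinuousLinearMap : (E →ₗᵢ[ℝ] F) → (E →L[ℝ] F)) =
      {f | ∀ x, ‖f x‖ = ‖x‖} := by
    ext f
    constructor
    · rintro ⟨g, rfl⟩ x
      exact g.norm_map x
    · intro h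
      exact ⟨⟨f.toLinearMap, h⟩, rfl⟩
  have hcl : IsClosed {f : E →L[ℝ] F | ∀ x, ‖f x‖ = ‖x‖} := by
    simp only [Set.ofPred_forall]
    exact isClosed_iInter fun x => isClosed_eq (by fun_prop) continuous_const
  have hsub : {f : E →L[ℝ] F | ∀ x, ‖f x‖ = ‖x‖} ⊆ Metric.closedBall 0 1 := by
    intro f hf
    rw [mem_closedBall_zero_iff]
    exact f.opNorm_le_bound zero_le_one fun x => by rw [hf x, one_mul]
  have : ProperSpace (E →L[ℝ] F) := FiniteDimensional.proper ℝ _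
  have hc := (isCompact_closedBall (0 : E →L[ℝ] F) 1).of_isClosed_subset hcl hsub
  rw [← hr] at hc
  rw [← isCompact_univ_iff, isEmbedding_toCLM.isCompact_iff, Set.image_univ]
  exact hc

end LinearIsometries

section Representations

/-- The vector space `⊕_{i ∈ ℕ} ℝ[C₂]`, with basis the vectors indexed by `(i, b)`, where
`b = false` stands for the element `e` of `C₂` and `b = true` for the element `σ`. -/
def RegSum : Type := (ℕ × Bool) →₀ ℝ

instance : AddCommGroup RegSum := inferInstanceAs (AddCommGroup ((ℕ × Bool) →₀ ℝ))

instance : Module ℝ RegSum := inferInstanceAs (Module ℝ ((ℕ × Bool) →₀ ℝ))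

/-- The coordinates of a vector. -/
def RegSum.coord (x : RegSum) : (ℕ × Bool) →₀ ℝ := x

/-- The inner product for which the standard basis is orthonormal. -/
@[reducible] def RegSum.core : InnerProductSpace.Core ℝ RegSum where
  inner x y := x.coord.sum fun i a => a * y.coord i
  conj_inner_symm x y := by
    change Finsupp.sum y.coord (fun i a => a * x.coord i) = Finsupp.sum x.coord _
    rw [Finsupp.sum_of_support_subset y.coord Finset.subset_union_right _ (by simp),
      Finsupp.sum_of_support_subset x.coord (Finset.subset_union_left (s₂ := y.coord.support)) _
        (by simp)]
    exact Finset.sum_congr rfl fun i _ => mul_comm _ _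
  re_inner_nonneg x := Finset.sum_nonneg fun i _ => mul_self_nonneg _
  add_left x y z := Finsupp.sum_add_index' (f := x.coord) (g := y.coord) (by simp)
    (fun _ _ _ => by ring)
  smul_left x y r := by
    change Finsupp.sum (r • x.coord) _ = r * Finsupp.sum x.coord _
    rw [Finsupp.sum_smul_index' (by simp), Finsupp.mul_sum]
    simp [mul_assoc]
  definite x h := by
    have h' : ∑ i ∈ x.coord.support, x.coord i * x.coord i = 0 := h
    rw [Finset.sum_eq_zero_iff_of_nonneg fun i _ => mul_self_nonneg _] at h'
    refine Finsupp.ext (f := x.coord) (g := 0) fun i => ?_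
    by_cases hi : i ∈ x.coord.support
    · exact mul_self_eq_zero.1 (h' i hi)
    · simpa using hi

instance : NormedAddCommGroup RegSum :=
  @InnerProductSpace.Core.toNormedAddCommGroup ℝ RegSum _ _ _ RegSum.core

instance : InnerProductSpace ℝ RegSum := InnerProductSpace.ofCore RegSum.core.toCore

theorem RegSum.inner_def (x y : RegSum) :
    inner ℝ x y = x.coord.sum fun i a => a * y.coord i := rfl

/-- The action of the generator `σ` of `C₂`: it exchanges the two basis vectors of each copy of
`ℝ[C₂]`. -/
def RegSum.sigma : RegSum →ₗᵢ[ℝ] RegSum :=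
  LinearMap.isometryOfInner
    (Finsupp.domLCongr (Equiv.prodCongr (Equiv.refl ℕ) Equiv.boolNot) :
      ((ℕ × Bool) →₀ ℝ) ≃ₗ[ℝ] ((ℕ × Bool) →₀ ℝ)).toLinearMap (fun x y => by
    let e : ℕ × Bool ≃ ℕ × Bool := Equiv.prodCongr (Equiv.refl ℕ) Equiv.boolNot
    change (Finsupp.equivMapDomain e x.coord).sum
      (fun i a => a * Finsupp.equivMapDomain e y.coord i) = x.coord.sum _
    rw [Finsupp.equivMapDomain_eq_mapDomain, Finsupp.sum_mapDomain_index_inj e.injective]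
    simp [Finsupp.equivMapDomain_apply])

theorem RegSum.sigma_coord (x : RegSum) (n : ℕ) (b : Bool) :
    (RegSum.sigma x).coord (n, b) = x.coord (n, !b) := rfl

theorem RegSum.sigma_sigma (x : RegSum) : RegSum.sigma (RegSum.sigma x) = x := by
  refine Finsupp.ext (f := (RegSum.sigma (RegSum.sigma x)).coord) (g := x.coord) ?_
  rintro ⟨n, b⟩
  rw [RegSum.sigma_coord, RegSum.sigma_coord, Bool.not_not]

/-- The objects of the indexing category: finite-dimensional subrepresentations of
`⊕_{i ∈ ℕ} ℝ[C₂]`, with the inherited inner product. -/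
structure Rep where
  /-- The underlying subspace. -/
  space : Submodule ℝ RegSum
  finiteDimensional : FiniteDimensional ℝ space
  sigma_mem : ∀ x ∈ space, RegSum.sigma x ∈ space

instance : CoeSort Rep Type := ⟨fun V => V.space⟩

instance (V : Rep) : FiniteDimensional ℝ V := V.finiteDimensional

/-- The action of `σ` on a representation. -/
def Rep.sigma (V : Rep) : V →ₗᵢ[ℝ] V where
  toLinearMap := RegSum.sigma.toLinearMap.restrict V.sigma_mem
  norm_map' x := RegSum.sigma.norm_map x

@[simp]
theorem Rep.sigma_sigma (V : Rep) (x : V) : V.sigma (V.sigma x) = x :=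
  Subtype.ext (RegSum.sigma_sigma x)

/-- The conjugation action `σ * f = σ f σ` of `C₂` on the space of (not necessarily equivariant)
linear isometries. -/
def conj {V W : Rep} (f : V →ₗᵢ[ℝ] W) : V →ₗᵢ[ℝ] W := W.sigma.comp (f.comp V.sigma)

@[simp]
theorem conj_apply {V W : Rep} (f : V →ₗᵢ[ℝ] W) (x : V) : conj f x = W.sigma (f (V.sigma x)) := rfl

@[simp]
theorem conj_conj {V W : Rep} (f : V →ₗᵢ[ℝ] W) : conj (conj f) = f := by
  ext x; simp

theorem conj_comp {U V W : Rep} (g : V →ₗᵢ[ℝ] W) (f : U →ₗᵢ[ℝ] V) :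
    conj (g.comp f) = (conj g).comp (conj f) := by
  ext x; simp

theorem continuous_conj {V W : Rep} : Continuous (conj : (V →ₗᵢ[ℝ] W) → (V →ₗᵢ[ℝ] W)) :=
  continuous_isometry_comp.comp (continuous_const.prodMk
    (continuous_isometry_comp.comp (continuous_id.prodMk continuous_const)))

end Representations

section InputCategory

/-- Pointed `C₂`-spaces: pointed compactly generated weak Hausdorff spaces with a basepoint
preserving continuous action of `C₂ = {e, σ}`, given by the involution by which `σ` acts. -/
structure C2Space where
  /-- The underlying set. -/
  carrier : Type u
  [top : TopologicalSpace carrier]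
  [compactlyGenerated : CompactlyGeneratedSpace carrier]
  [weaklyHausdorff : WeaklyHausdorff carrier]
  /-- The basepoint. -/
  pt : carrier
  /-- The action of `σ`. -/
  sigma : carrier → carrier
  continuous_sigma : Continuous sigma
  sigma_sigma : ∀ x, sigma (sigma x) = x
  sigma_pt : sigma pt = pt

instance : CoeSort C2Space.{u} (Type u) := ⟨C2Space.carrier⟩

instance (X : C2Space.{u}) : TopologicalSpace X := X.top

instance (X : C2Space.{u}) : CompactlyGeneratedSpace X := X.compactlyGenerated

instance (X : C2Space.{u}) : WeaklyHausdorff X := X.weaklyHausdorff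

/-- Morphisms of pointed `C₂`-spaces: equivariant pointed continuous maps. -/
structure C2Map (X Y : C2Space.{u}) where
  /-- The underlying function. -/
  toFun : X → Y
  continuous_toFun : Continuous toFun
  map_pt : toFun X.pt = Y.pt
  map_sigma : ∀ x, toFun (X.sigma x) = Y.sigma (toFun x)

/-- The underlying continuous map. -/
def C2Map.toContinuousMap {X Y : C2Space.{u}} (f : C2Map X Y) : C(X, Y) :=
  ⟨f.toFun, f.continuous_toFun⟩

/-- The space `X^{C₂}` of fixed points. -/
def C2Space.FixedPoints (X : C2Space.{u}) : Type u := {x : X // X.sigma x = x}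

instance (X : C2Space.{u}) : TopologicalSpace X.FixedPoints :=
  inferInstanceAs (TopologicalSpace {x : X // X.sigma x = x})

/-- The map induced on fixed points. -/
def C2Map.fixedPoints {X Y : C2Space.{u}} (f : C2Map X Y) : C(X.FixedPoints, Y.FixedPoints) where
  toFun x := ⟨f.toFun x.1, by rw [← f.map_sigma, x.2]⟩
  continuous_toFun :=
    Continuous.subtype_mk (f.continuous_toFun.comp continuous_subtype_val) _

/-- Weak equivalences of the fine model structure on pointed `C₂`-spaces: maps which induce weak
homotopy equivalences on `H`-fixed points for both subgroups `H` of `C₂`. -/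
structure C2Map.IsWeakEquiv {X Y : C2Space.{u}} (f : C2Map X Y) : Prop where
  underlying : IsWeakHomotopyEquiv f.toContinuousMap
  fixedPoints : IsWeakHomotopyEquiv f.fixedPoints

/-- The objects of the input category: functors, enriched in pointed `C₂`-spaces, from the
category of representations with morphism spaces `L(U, V)₊` to pointed `C₂`-spaces. Here `L(U, V)`
is the space of all linear isometries with the conjugation action. A continuous pointed map from
`L(U, V)₊` to the space of pointed maps `E(U) → E(V)` is written as a continuous map
`L(U, V) × E(U) → E(V)` which is pointed in the second variable. -/
structure InputFunctor where
  /-- The value at a representation. -/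
  obj : Rep → C2Space.{u}
  /-- The value at a linear isometry. -/
  map : ∀ {U V : Rep}, (U →ₗᵢ[ℝ] V) → obj U → obj V
  continuous_map : ∀ U V : Rep,
    Continuous fun z : (U →ₗᵢ[ℝ] V) × obj U => (map z.1 z.2 : obj V)
  map_pt : ∀ {U V : Rep} (f : U →ₗᵢ[ℝ] V), map f (obj U).pt = (obj V).pt
  map_id : ∀ (U : Rep) (x : obj U), map (LinearIsometry.id : U →ₗᵢ[ℝ] U) x = x
  map_comp : ∀ {U V W : Rep} (g : V →ₗᵢ[ℝ] W) (f : U →ₗᵢ[ℝ] V) (x : obj U),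
    map (g.comp f) x = map g (map f x)
  map_conj : ∀ {U V : Rep} (f : U →ₗᵢ[ℝ] V) (x : obj U),
    map (conj f) x = (obj V).sigma (map f ((obj U).sigma x))

theorem InputFunctor.sigma_map (E : InputFunctor.{u}) {U V : Rep} (f : U →ₗᵢ[ℝ] V)
    (x : E.obj U) : (E.obj V).sigma (E.map f x) = E.map (conj f) ((E.obj U).sigma x) := by
  rw [E.map_conj, C2Space.sigma_sigma]

/-- Morphisms of the input category: `C₂`-equivariant natural transformations. -/
structure InputFunctor.Hom (E F : InputFunctor.{u}) where
  /-- The component at a representation. -/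
  app : ∀ V : Rep, C2Map (E.obj V) (F.obj V)
  naturality : ∀ {U V : Rep} (f : U →ₗᵢ[ℝ] V) (x : E.obj U),
    (app V).toFun (E.map f x) = F.map f ((app U).toFun x)

/-- Objectwise weak equivalences. -/
def InputFunctor.Hom.IsObjectwiseWeakEquiv {E F : InputFunctor.{u}} (s : E.Hom F) : Prop :=
  ∀ V : Rep, (s.app V).IsWeakEquiv

end InputCategory

section Tau

variable (p q : ℕ)

/-- The total space of the unit sphere bundle of the `(p, q)`-th complement bundle: pairs `(f, x)`
of a linear isometry `f : V → W` and a unit vector `x` of `ℝ^{p,q} ⊗ f(V)^⊥`. A vector of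
`ℝ^{p,q} ⊗ W` is given by its components in `W` with respect to the standard orthonormal basis of
`ℝ^{p,q} = ℝ^p ⊕ ℝ^{qδ}`. -/
def SphereBundle (V W : Rep) : Type :=
  {z : (V →ₗᵢ[ℝ] W) × (Fin p ⊕ Fin q → W) //
    (∀ i, z.2 i ∈ (LinearMap.range z.1.toLinearMap)ᗮ) ∧ ∑ i, ‖z.2 i‖ ^ 2 = 1}

instance (V W : Rep) : TopologicalSpace (SphereBundle p q V W) :=
  inferInstanceAs (TopologicalSpace (Subtype _))

variable {p q}

theorem mem_range_perp {V W : Rep} {f : V →ₗᵢ[ℝ] W} {x : W} :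
    x ∈ (LinearMap.range f.toLinearMap)ᗮ ↔ ∀ v, inner ℝ (f v) x = 0 := by
  rw [Submodule.mem_orthogonal]
  constructor
  · exact fun h v => h _ ⟨v, rfl⟩
  · rintro h _ ⟨v, rfl⟩
    exact h v

instance (V W : Rep) : LocallyCompactSpace (SphereBundle p q V W) := by
  have hcl : IsClosed {z : (V →ₗᵢ[ℝ] W) × (Fin p ⊕ Fin q → W) |
    (∀ i, z.2 i ∈ (LinearMap.range z.1.toLinearMap)ᗮ) ∧ ∑ i, ‖z.2 i‖ ^ 2 = 1} := by
    simp only [mem_range_perp]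
    refine IsClosed.and ?_ (isClosed_eq (by fun_prop) continuous_const)
    simp only [Set.ofPred_forall]
    refine isClosed_iInter fun i => isClosed_iInter fun v => isClosed_eq ?_ continuous_const
    have h : Continuous fun z : (V →ₗᵢ[ℝ] W) × (Fin p ⊕ Fin q → W) => z.1 v :=
      continuous_isometry_apply.comp (continuous_fst.prodMk continuous_const)
    fun_prop
  have : ProperSpace (Fin p ⊕ Fin q → W) := FiniteDimensional.proper ℝ _
  exact hcl.isClosedEmbedding_subtypeVal.locallyCompactSpace

/-- Covariant functoriality of the sphere bundle: `(f, x) ↦ (h f, (id ⊗ h) x)`. -/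
def SphereBundle.post {V W W' : Rep} (h : W →ₗᵢ[ℝ] W') (z : SphereBundle p q V W) :
    SphereBundle p q V W' :=
  ⟨(h.comp z.1.1, fun i => h (z.1.2 i)), fun i => by
    rw [mem_range_perp]
    intro v
    have := mem_range_perp.1 (z.2.1 i) v
    simpa using this, by simpa using z.2.2⟩

/-- Contravariant functoriality of the sphere bundle: `(f, x) ↦ (f g, x)`. -/
def SphereBundle.pre {V V' W : Rep} (g : V →ₗᵢ[ℝ] V') (z : SphereBundle p q V' W) :
    SphereBundle p q V W :=
  ⟨(z.1.1.comp g, z.1.2), fun i => by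
    rw [mem_range_perp]
    intro v
    exact mem_range_perp.1 (z.2.1 i) (g v), z.2.2⟩

theorem SphereBundle.continuous_pre {V V' W : Rep} :
    Continuous fun y : (V →ₗᵢ[ℝ] V') × SphereBundle p q V' W => SphereBundle.pre y.1 y.2 := by
  refine Continuous.subtype_mk (Continuous.prodMk ?_ ?_) _
  · exact continuous_isometry_comp.comp ((continuous_fst.comp
      (continuous_subtype_val.comp continuous_snd)).prodMk continuous_fst)
  · exact continuous_snd.comp (continuous_subtype_val.comp continuous_snd)

/-- The action of `σ` on the sphere bundle: `(f, x) ↦ (σ f σ, σ x)`, where `σ` acts diagonally on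
`ℝ^{p,q} ⊗ W`, that is, on the components in `W` by `σ` for the `p` trivial summands and by `-σ`
for the `q` sign summands. -/
def SphereBundle.sigma {V W : Rep} (z : SphereBundle p q V W) : SphereBundle p q V W :=
  ⟨(conj z.1.1, Sum.elim (fun i => W.sigma (z.1.2 (Sum.inl i)))
      (fun j => -W.sigma (z.1.2 (Sum.inr j)))), by
    have key : ∀ i v, inner ℝ (W.sigma (z.1.1 (V.sigma v))) (W.sigma (z.1.2 i)) = 0 := by
      intro i v
      rw [LinearIsometry.inner_map_map]
      exact mem_range_perp.1 (z.2.1 i) _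
    rintro (i | j) <;> rw [mem_range_perp] <;> intro v
    · exact key _ v
    · simpa [inner_neg_right] using key (Sum.inr j) v, by
    have := z.2.2
    rw [Fintype.sum_sum_type] at this ⊢
    simpa using this⟩

theorem SphereBundle.ext {V W : Rep} {z z' : SphereBundle p q V W} (h₁ : z.1.1 = z'.1.1)
    (h₂ : ∀ i, z.1.2 i = z'.1.2 i) : z = z' :=
  Subtype.ext (Prod.ext h₁ (funext h₂))

@[simp]
theorem SphereBundle.sigma_sigma {V W : Rep} (z : SphereBundle p q V W) : z.sigma.sigma = z :=
  SphereBundle.ext (conj_conj _) (by rintro (i | j) <;> simp [SphereBundle.sigma])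

theorem SphereBundle.sigma_post {V W W' : Rep} (h : W →ₗᵢ[ℝ] W') (z : SphereBundle p q V W) :
    (z.post h).sigma = z.sigma.post (conj h) :=
  SphereBundle.ext (conj_comp _ _)
    (by rintro (i | j) <;> simp [SphereBundle.sigma, SphereBundle.post])

theorem SphereBundle.sigma_pre {V V' W : Rep} (g : V →ₗᵢ[ℝ] V') (z : SphereBundle p q V' W) :
    (z.pre g).sigma = z.sigma.pre (conj g) :=
  SphereBundle.ext (conj_comp _ _)
    (by rintro (i | j) <;> rfl)

theorem SphereBundle.continuous_sigma {V W : Rep} :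
    Continuous (SphereBundle.sigma : SphereBundle p q V W → _) := by
  refine Continuous.subtype_mk (Continuous.prodMk ?_ (continuous_pi ?_)) _
  · exact continuous_conj.comp (continuous_fst.comp continuous_subtype_val)
  · have h : ∀ i, Continuous fun z : SphereBundle p q V W => W.sigma (z.1.2 i) := fun i =>
      W.sigma.continuous.comp
        ((continuous_apply i).comp (continuous_snd.comp continuous_subtype_val))
    rintro (i | j)
    · exact h _
    · exact (h _).neg

/-- Natural transformations (not necessarily `C₂`-equivariant) from the sphere bundle functor
`W ↦ S(V, W)₊` to `E`. A pointed map from `S(V, W)₊` is the same as an unpointed map from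
`S(V, W)`. -/
def NatTransf (p q : ℕ) (E : InputFunctor.{u}) (V : Rep) : Type u :=
  {α : ∀ W : Rep, C(SphereBundle p q V W, E.obj W) //
    ∀ (W W' : Rep) (h : W →ₗᵢ[ℝ] W') (z : SphereBundle p q V W),
      α W' (z.post h) = E.map h (α W z)}

/-- The topology as a subspace of the product of the mapping spaces. -/
instance (E : InputFunctor.{u}) (V : Rep) : TopologicalSpace (NatTransf p q E V) :=
  inferInstanceAs (TopologicalSpace (Subtype _))

theorem NatTransf.ext {E : InputFunctor.{u}} {V : Rep} {α β : NatTransf p q E V}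
    (h : ∀ W z, α.1 W z = β.1 W z) : α = β :=
  Subtype.ext (funext fun W => ContinuousMap.ext (h W))

theorem NatTransf.continuous_component {E : InputFunctor.{u}} {V : Rep} (W : Rep) :
    Continuous fun α : NatTransf p q E V => α.1 W := by
  have h : Continuous (Subtype.val : NatTransf p q E V → _) := continuous_subtype_val
  exact (continuous_apply W).comp h

/-- The conjugation action of `σ` on natural transformations. -/
def NatTransf.sigma {E : InputFunctor.{u}} {V : Rep} (α : NatTransf p q E V) :
    NatTransf p q E V :=
  ⟨fun W => ⟨fun z => (E.obj W).sigma (α.1 W z.sigma), (E.obj W).continuous_sigma.comp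
    ((α.1 W).continuous.comp SphereBundle.continuous_sigma)⟩, fun W W' h z => by
      simp only [ContinuousMap.coe_mk]
      rw [SphereBundle.sigma_post, α.2, E.sigma_map, conj_conj]⟩

/-- Precomposition with the map of sphere bundles induced by a linear isometry `g : V → V'`. -/
def NatTransf.map {E : InputFunctor.{u}} {V V' : Rep} (g : V →ₗᵢ[ℝ] V')
    (α : NatTransf p q E V) : NatTransf p q E V' :=
  ⟨fun W => ⟨fun z => α.1 W (z.pre g), (α.1 W).continuous.comp
    (SphereBundle.continuous_pre.comp (continuous_const.prodMk continuous_id))⟩,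
    fun W W' h z => α.2 W W' h (z.pre g)⟩

theorem NatTransf.continuous_sigma {E : InputFunctor.{u}} {V : Rep} :
    Continuous (NatTransf.sigma : NatTransf p q E V → _) := by
  refine Continuous.subtype_mk (continuous_pi fun W => ?_) _
  refine ContinuousMap.continuous_of_continuous_uncurry _ ?_
  have h : Continuous fun y : NatTransf p q E V × SphereBundle p q V W =>
      y.1.1 W y.2.sigma :=
    ContinuousEval.continuous_eval.comp
      (((NatTransf.continuous_component W).comp continuous_fst).prodMk
        (SphereBundle.continuous_sigma.comp continuous_snd))
  exact (E.obj W).continuous_sigma.comp h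

theorem NatTransf.continuous_map {E : InputFunctor.{u}} {V V' : Rep} :
    Continuous fun y : (V →ₗᵢ[ℝ] V') × NatTransf p q E V => NatTransf.map y.1 y.2 := by
  refine Continuous.subtype_mk (continuous_pi fun W => ?_) _
  refine ContinuousMap.continuous_of_continuous_uncurry _ ?_
  have h : Continuous fun y : ((V →ₗᵢ[ℝ] V') × NatTransf p q E V) × SphereBundle p q V' W =>
      y.1.2.1 W (y.2.pre y.1.1) :=
    ContinuousEval.continuous_eval.comp
      (((NatTransf.continuous_component W).comp (continuous_snd.comp continuous_fst)).prodMk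
        (SphereBundle.continuous_pre.comp
          ((continuous_fst.comp continuous_fst).prodMk continuous_snd)))
  exact h

variable (p q) in
/-- The pointed `C₂`-space `τ_{p,q} E (V)` of natural transformations from `S(V, -)₊` to `E`. -/
def tauObj (E : InputFunctor.{u}) (V : Rep) : C2Space.{u} where
  carrier := Kify (NatTransf p q E V)
  weaklyHausdorff := wh_of_injective Kify.val Kify.continuous_val (fun _ _ => Kify.ext)
    fun K _ _ _ f g hf hg => by
      have : {k | f k = g k} = ⋂ W, ⋂ z, {k | (f k).1 W z = (g k).1 W z} := by
        ext k
        simp only [Set.mem_iInter]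
        exact ⟨fun h W z => congrArg (fun α : NatTransf p q E V => α.1 W z) h,
          fun h => NatTransf.ext fun W z => h W z⟩
      rw [this]
      have ev : ∀ W z, Continuous fun α : NatTransf p q E V => α.1 W z := fun W z =>
        (ContinuousEvalConst.continuous_eval_const z).comp (NatTransf.continuous_component W)
      exact isClosed_iInter fun W => isClosed_iInter fun z =>
        isClosed_eq_of_wh ((ev W z).comp hf) ((ev W z).comp hg)
  pt := ⟨⟨fun W => ContinuousMap.const _ (E.obj W).pt, fun _ _ h _ => (E.map_pt h).symm⟩⟩
  sigma α := ⟨α.val.sigma⟩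
  continuous_sigma :=
    Kify.continuous_mk_comp (NatTransf.continuous_sigma.comp Kify.continuous_val)
  sigma_sigma α := Kify.ext (NatTransf.ext fun W z => by
    simp [NatTransf.sigma, C2Space.sigma_sigma])
  sigma_pt := Kify.ext (NatTransf.ext fun W z => (E.obj W).sigma_pt)

variable (p q) in
/-- The functor `τ_{p,q} E`. -/
def tau (E : InputFunctor.{u}) : InputFunctor.{u} where
  obj := tauObj p q E
  map g α := ⟨α.val.map g⟩
  continuous_map V V' := by
    have : CompactlyGeneratedSpace ((V →ₗᵢ[ℝ] V') × tauObj p q E V) :=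
      compactlyGenerated_prod _ _
    exact Kify.continuous_mk_comp (NatTransf.continuous_map.comp
      (continuous_fst.prodMk (Kify.continuous_val.comp continuous_snd)))
  map_pt _ := rfl
  map_id _ _ := rfl
  map_comp _ _ _ := rfl
  map_conj g α := Kify.ext (NatTransf.ext fun W z => by
    change α.val.1 W (z.pre (conj g)) =
      (E.obj W).sigma ((E.obj W).sigma (α.val.1 W ((z.sigma.pre g).sigma)))
    rw [C2Space.sigma_sigma, SphereBundle.sigma_pre, SphereBundle.sigma_sigma])

variable (p q) in
/-- The morphism `ρ_{p,q} E : E → τ_{p,q} E`. By the Yoneda lemma a point `x` of `E(V)` is a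
natural transformation `f ↦ E(f)(x)` on `L(V, -)₊`, which is restricted along the projection
`(f, y) ↦ f` of the sphere bundle. -/
def rho (E : InputFunctor.{u}) : E.Hom (tau p q E) where
  app V :=
    { toFun := fun x => ⟨⟨fun W => ⟨fun z => E.map z.1.1 x, (E.continuous_map V W).comp
          ((continuous_fst.comp continuous_subtype_val).prodMk continuous_const)⟩,
          fun _ _ _ _ => E.map_comp _ _ _⟩⟩
      continuous_toFun := by
        refine Kify.continuous_mk_comp (Continuous.subtype_mk (continuous_pi fun W => ?_) _)
        refine ContinuousMap.continuous_of_continuous_uncurry _ ?_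
        exact (E.continuous_map V W).comp ((continuous_fst.comp
          (continuous_subtype_val.comp continuous_snd)).prodMk continuous_fst)
      map_pt := Kify.ext (NatTransf.ext fun W z => E.map_pt _)
      map_sigma := fun x => Kify.ext (NatTransf.ext fun W z => by
        change E.map z.1.1 _ = (E.obj W).sigma (E.map (conj z.1.1) x)
        rw [E.sigma_map, conj_conj]) }
  naturality f x := Kify.ext (NatTransf.ext fun W z => (E.map_comp _ _ _).symm)

variable (p q) in
/-- A functor `E` is strongly `(p, q)`-polynomial if `ρ_{p,q} E` is an objectwise weak
equivalence. -/
def IsStronglyPolynomial (E : InputFunctor.{u}) : Prop := (rho p q E).IsObjectwiseWeakEquiv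

end Tau

section Telescope

variable (X : ℕ → InputFunctor.{u}) (s : ∀ k, (X k).Hom (X (k + 1)))

/-- The disjoint union of the cylinders `X_k(V) × [0, 1]`. -/
abbrev PreTelescope (V : Rep) : Type u := Σ k : ℕ, I × (X k).obj V

variable {X} in
/-- The end `(x, 1)` of the `k`-th cylinder is glued to the point `(s x, 0)` of the next one. -/
inductive Glue (V : Rep) : PreTelescope X V → PreTelescope X V → Prop
  | mk (k : ℕ) (x : (X k).obj V) : Glue V ⟨k, (1, x)⟩ ⟨k + 1, (0, ((s k).app V).toFun x)⟩

variable {X}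

/-- The underlying space of the mapping telescope of the sequence
`X_0(V) → X_1(V) → X_2(V) → ⋯`. -/
def Telescope (V : Rep) : Type u := Quot (Glue s V)

instance (V : Rep) : TopologicalSpace (Telescope s V) :=
  inferInstanceAs (TopologicalSpace (Quot _))

instance (V : Rep) : CompactlyGeneratedSpace (PreTelescope X V) := by
  have : ∀ k, CompactlyGeneratedSpace (I × (X k).obj V) := fun k => compactlyGenerated_prod _ _
  infer_instance

/-- The quotient map. -/
def Telescope.mk (V : Rep) (a : PreTelescope X V) : Telescope s V := Quot.mk _ a

theorem Telescope.isQuotientMap_mk (V : Rep) : IsQuotientMap (Telescope.mk s V) :=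
  isQuotientMap_quot_mk

instance (V : Rep) : CompactlyGeneratedSpace (Telescope s V) :=
  compactlyGeneratedSpace_of_coinduced (Telescope.isQuotientMap_mk s V).continuous
    (Telescope.isQuotientMap_mk s V).eq_coinduced

theorem Telescope.glue (V : Rep) (k : ℕ) (x : (X k).obj V) :
    Telescope.mk s V ⟨k, (1, x)⟩ = Telescope.mk s V ⟨k + 1, (0, ((s k).app V).toFun x)⟩ :=
  Quot.sound (Glue.mk k x)

/-- Functions on the telescope. -/
def Telescope.lift {V : Rep} {Z : Type*} (g : ∀ k, I → (X k).obj V → Z)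
    (hg : ∀ k x, g k 1 x = g (k + 1) 0 (((s k).app V).toFun x)) : Telescope s V → Z :=
  Quot.lift (fun a => g a.1 a.2.1 a.2.2) (by rintro _ _ ⟨k, x⟩; exact hg k x)

theorem Telescope.continuous_lift {V : Rep} {Z : Type*} [TopologicalSpace Z]
    (g : ∀ k, I → (X k).obj V → Z)
    (hg : ∀ k x, g k 1 x = g (k + 1) 0 (((s k).app V).toFun x))
    (h : ∀ k, Continuous fun z : I × (X k).obj V => g k z.1 z.2) :
    Continuous (Telescope.lift s g hg) :=
  continuous_quot_lift _ (continuous_sigma h)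

theorem Telescope.ind {V : Rep} {P : Telescope s V → Prop}
    (h : ∀ k t x, P (Telescope.mk s V ⟨k, (t, x)⟩)) (a : Telescope s V) : P a :=
  Quot.ind (fun ⟨k, t, x⟩ => h k t x) a

/-- The height of a point of the telescope. -/
def Telescope.height (V : Rep) : Telescope s V → ℝ :=
  Telescope.lift s (fun k t _ => k + t) (by intro k x; push_cast; simp)

theorem Telescope.continuous_height (V : Rep) : Continuous (Telescope.height s V) :=
  Telescope.continuous_lift s _ _ fun k => by fun_prop

/-- The iterated structure map `X_k(V) → X_n(V)`. -/
def push (V : Rep) {k n : ℕ} (h : k ≤ n) (x : (X k).obj V) : (X n).obj V :=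
  Nat.leRecOn (C := fun k => (X k).obj V) h (fun {k} => ((s k).app V).toFun) x

theorem push_self (V : Rep) {k : ℕ} (x : (X k).obj V) : push s V le_rfl x = x :=
  Nat.leRecOn_self (C := fun k => (X k).obj V) x

theorem push_left (V : Rep) {k n : ℕ} (h : k + 1 ≤ n) (x : (X k).obj V) :
    push s V h (((s k).app V).toFun x) = push s V (Nat.le_of_succ_le h) x :=
  Nat.leRecOn_succ_left (C := fun k => (X k).obj V) x _ h

theorem continuous_push (V : Rep) {k n : ℕ} (h : k ≤ n) : Continuous (push s V h) := by
  induction n, h using Nat.le_induction with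
  | base =>
    rw [show push s V (le_refl k) = id from funext (push_self s V)]
    exact continuous_id
  | succ n h ih =>
    have e : push s V (Nat.le_succ_of_le h) = ((s n).app V).toFun ∘ push s V h :=
      funext fun x => Nat.leRecOn_succ (C := fun k => (X k).obj V) h x
    rw [e]
    exact ((s n).app V).continuous_toFun.comp ih

open Classical in
/-- The retraction of the part of the telescope of height less than `n + 1` to `X_n(V)`, extended
by the basepoint. -/
def Telescope.retract (V : Rep) (n : ℕ) : Telescope s V → (X n).obj V :=
  Telescope.lift s
    (fun k t x => if h : k ≤ n ∧ (k : ℝ) + t < n + 1 then push s V h.1 x else ((X n).obj V).pt)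
    (by
      intro k x
      by_cases h : k + 1 ≤ n
      · have h' : (k : ℝ) + 1 ≤ n := by exact_mod_cast h
        rw [dif_pos ⟨by omega, by simpa using by linarith⟩,
          dif_pos ⟨h, by push_cast; simpa using by linarith⟩, push_left]
      · rw [dif_neg, dif_neg (fun hc => h hc.1)]
        rintro ⟨h1, h2⟩
        have : k = n := by omega
        subst this
        simp at h2)

theorem Telescope.retract_mk (V : Rep) {n k : ℕ} (h : k ≤ n) {t : I}
    (ht : (k : ℝ) + t < n + 1) (x : (X k).obj V) :
    Telescope.retract s V n (Telescope.mk s V ⟨k, (t, x)⟩) = push s V h x :=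
  dif_pos ⟨h, ht⟩

theorem Telescope.continuousOn_retract (V : Rep) (n : ℕ) :
    ContinuousOn (Telescope.retract s V n) {a | Telescope.height s V a < n + 1} := by
  have ho : IsOpen {a | Telescope.height s V a < n + 1} :=
    isOpen_lt (Telescope.continuous_height s V) continuous_const
  rw [(Telescope.isQuotientMap_mk s V).continuousOn_isOpen_iff ho]
  rintro ⟨k, t, x⟩ hk
  have hk' : (k : ℝ) + t < n + 1 := hk
  have hkn : k ≤ n := by
    have h0 := t.2.1
    have : (k : ℝ) < n + 1 := by linarith
    exact Nat.lt_succ_iff.1 (by exact_mod_cast this)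
  refine ContinuousAt.continuousWithinAt ?_
  have hopen : IsOpen {z : I × (X k).obj V | (k : ℝ) + z.1 < n + 1} :=
    isOpen_lt (by fun_prop) continuous_const
  have hc : ContinuousAt (fun z : I × (X k).obj V => push s V hkn z.2) (t, x) :=
    ((continuous_push s V hkn).comp continuous_snd).continuousAt
  have hc' : ContinuousAt (fun z : I × (X k).obj V =>
      (Telescope.retract s V n ∘ Telescope.mk s V) ⟨k, z⟩) (t, x) := by
    refine hc.congr ?_
    filter_upwards [hopen.mem_nhds hk'] with z hz
    exact (Telescope.retract_mk s V hkn hz z.2).symm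
  rw [ContinuousAt, Sigma.nhds_mk, Filter.tendsto_map'_iff]
  exact hc'

theorem Telescope.exists_rep (V : Rep) (a : Telescope s V) :
    ∃ (k : ℕ) (t : I) (x : (X k).obj V), (t : ℝ) < 1 ∧ a = Telescope.mk s V ⟨k, (t, x)⟩ := by
  induction a using Telescope.ind with
  | h k t x =>
    rcases lt_or_eq_of_le t.2.2 with h | h
    · exact ⟨k, t, x, h, rfl⟩
    · obtain rfl : t = 1 := Subtype.ext h
      exact ⟨k + 1, 0, _, by simp, Telescope.glue s V k x⟩

theorem Telescope.eq_of_retract (V : Rep) (n : ℕ) {a b : Telescope s V}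
    (hab : Telescope.height s V a = Telescope.height s V b)
    (h₁ : (n : ℝ) ≤ Telescope.height s V a) (h₂ : Telescope.height s V a < n + 1)
    (hr : Telescope.retract s V n a = Telescope.retract s V n b) : a = b := by
  obtain ⟨k, t, x, ht, rfl⟩ := Telescope.exists_rep s V a
  obtain ⟨l, r, y, hr', rfl⟩ := Telescope.exists_rep s V b
  have e₁ : Telescope.height s V (Telescope.mk s V ⟨k, (t, x)⟩) = k + t := rfl
  have e₂ : Telescope.height s V (Telescope.mk s V ⟨l, (r, y)⟩) = l + r := rfl
  have ht0 := t.2.1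
  have hr0 := r.2.1
  rw [e₁, e₂] at hab
  rw [e₁] at h₁ h₂
  have aux : ∀ m : ℕ, (m : ℝ) < n + 1 → (n : ℝ) < m + 1 → m = n := by
    intro m a b
    have a' : m < n + 1 := by exact_mod_cast a
    have b' : n < m + 1 := by exact_mod_cast b
    omega
  obtain rfl := aux k (by linarith) (by linarith)
  obtain rfl := aux l (by linarith) (by linarith)
  have htr : t = r := Subtype.ext (by linarith)
  subst htr
  have hx : Telescope.retract s V l (Telescope.mk s V ⟨l, (t, x)⟩) = x :=
    (Telescope.retract_mk s V le_rfl h₂ x).trans (push_self s V x)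
  have hy : Telescope.retract s V l (Telescope.mk s V ⟨l, (t, y)⟩) = y :=
    (Telescope.retract_mk s V le_rfl h₂ y).trans (push_self s V y)
  rw [hx, hy] at hr
  rw [hr]

instance (V : Rep) : WeaklyHausdorff (Telescope s V) := by
  refine wh_of_isClosed_eq fun K _ _ _ f g hf hg => ?_
  have hhf := (Telescope.continuous_height s V).comp hf
  have hhg := (Telescope.continuous_height s V).comp hg
  refine isClosed_of_closure_subset fun k hk => ?_
  have hh : Telescope.height s V (f k) = Telescope.height s V (g k) := by
    have hcl : IsClosed {k | Telescope.height s V (f k) = Telescope.height s V (g k)} :=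
      isClosed_eq hhf hhg
    exact closure_minimal (fun l (hl : f l = g l) => congrArg (Telescope.height s V) hl) hcl hk
  have hpos : 0 ≤ Telescope.height s V (f k) := by
    obtain ⟨m, t, x, -, e⟩ := Telescope.exists_rep s V (f k)
    have e₁ : Telescope.height s V (Telescope.mk s V ⟨m, (t, x)⟩) = m + t := rfl
    rw [e, e₁]
    have := t.2.1
    positivity
  set n := ⌊Telescope.height s V (f k)⌋₊ with hn
  have h₁ : (n : ℝ) ≤ Telescope.height s V (f k) := Nat.floor_le hpos
  have h₂ : Telescope.height s V (f k) < n + 1 := Nat.lt_floor_add_one _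
  obtain ⟨c, hc₁, hc₂⟩ := exists_between h₂
  let C : Set K := {l | Telescope.height s V (f l) ≤ c ∧ Telescope.height s V (g l) ≤ c}
  have hC : IsClosed C := (isClosed_le hhf continuous_const).inter
    (isClosed_le hhg continuous_const)
  have : CompactSpace C := isCompact_iff_compactSpace.1 hC.isCompact
  have hCn : C ∈ 𝓝 k := by
    have o₁ : IsOpen {l | Telescope.height s V (f l) < c} := isOpen_lt hhf continuous_const
    have o₂ : IsOpen {l | Telescope.height s V (g l) < c} := isOpen_lt hhg continuous_const
    filter_upwards [o₁.mem_nhds hc₁, o₂.mem_nhds (show Telescope.height s V (g k) < c from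
      hh ▸ hc₁)] with l a b using ⟨le_of_lt a, le_of_lt b⟩
  have cf : Continuous fun l : C => Telescope.retract s V n (f l) :=
    (Telescope.continuousOn_retract s V n).comp_continuous (hf.comp continuous_subtype_val)
      fun l => lt_of_le_of_lt l.2.1 hc₂
  have cg : Continuous fun l : C => Telescope.retract s V n (g l) :=
    (Telescope.continuousOn_retract s V n).comp_continuous (hg.comp continuous_subtype_val)
      fun l => lt_of_le_of_lt l.2.2 hc₂
  have hcl := (isClosed_eq_of_wh cf cg).trans hC
  refine Telescope.eq_of_retract s V n hh h₁ h₂ ?_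
  have hk' : k ∈ closure (C ∩ {k | f k = g k}) := by
    rw [mem_closure_iff_nhds] at hk ⊢
    intro U hU
    obtain ⟨l, ⟨hl₁, hl₂⟩, hl₃⟩ := hk (U ∩ C) (Filter.inter_mem hU hCn)
    exact ⟨l, hl₁, hl₂, hl₃⟩
  obtain ⟨⟨l, hl⟩, hl', rfl⟩ := closure_minimal (fun l (hl : l ∈ C ∩ {k | f k = g k}) =>
    (⟨⟨l, hl.1⟩, congrArg (Telescope.retract s V n) hl.2, rfl⟩ :
      l ∈ Subtype.val '' {l : C | Telescope.retract s V n (f l) = Telescope.retract s V n (g l)}))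
    hcl hk'
  exact hl'

/-- The value of the mapping telescope at a representation. The basepoint is the basepoint of the
start of the first cylinder. -/
def telescopeObj (V : Rep) : C2Space.{u} where
  carrier := Telescope s V
  pt := Telescope.mk s V ⟨0, (0, ((X 0).obj V).pt)⟩
  sigma := Telescope.lift s (fun k t x => Telescope.mk s V ⟨k, (t, ((X k).obj V).sigma x)⟩)
    (fun k x => by rw [Telescope.glue, ((s k).app V).map_sigma])
  continuous_sigma := Telescope.continuous_lift s _ _ fun k =>
    (Telescope.isQuotientMap_mk s V).continuous.comp (continuous_sigmaMk.comp
      (continuous_fst.prodMk (((X k).obj V).continuous_sigma.comp continuous_snd)))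
  sigma_sigma := Telescope.ind s fun k t x =>
    congrArg (fun y => Telescope.mk s V ⟨k, (t, y)⟩) (((X k).obj V).sigma_sigma x)
  sigma_pt := congrArg (fun y => Telescope.mk s V ⟨0, (0, y)⟩) ((X 0).obj V).sigma_pt

/-- The homotopy colimit of a sequence `X_0 → X_1 → X_2 → ⋯` of morphisms of the input category,
as the objectwise mapping telescope. -/
def hocolim : InputFunctor.{u} where
  obj := telescopeObj s
  map {U V} f := Telescope.lift s (fun k t x => Telescope.mk s V ⟨k, (t, (X k).map f x)⟩)
    (fun k x => by rw [Telescope.glue, (s k).naturality])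
  continuous_map U V := by
    let F : Telescope s U → C((U →ₗᵢ[ℝ] V), Telescope s V) := Telescope.lift s
      (fun k t x => ⟨fun f => Telescope.mk s V ⟨k, (t, (X k).map f x)⟩,
        (Telescope.isQuotientMap_mk s V).continuous.comp (continuous_sigmaMk.comp
          (continuous_const.prodMk (((X k).continuous_map U V).comp
            (continuous_id.prodMk continuous_const))))⟩)
      (fun k x => ContinuousMap.ext fun f => by
        simp only [ContinuousMap.coe_mk]
        rw [Telescope.glue, (s k).naturality])
    have hF : Continuous F := Telescope.continuous_lift s _ _ fun k =>
      ContinuousMap.continuous_of_continuous_uncurry _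
        ((Telescope.isQuotientMap_mk s V).continuous.comp (continuous_sigmaMk.comp
          ((continuous_fst.comp continuous_fst).prodMk (((X k).continuous_map U V).comp
            (continuous_snd.prodMk (continuous_snd.comp continuous_fst))))))
    have h : Continuous fun z : (U →ₗᵢ[ℝ] V) × Telescope s U => F z.2 z.1 := by fun_prop
    refine h.congr ?_
    rintro ⟨f, a⟩
    induction a using Telescope.ind with
    | h k t x => rfl
  map_pt {U V} f := congrArg (fun y => Telescope.mk s V ⟨0, (0, y)⟩) ((X 0).map_pt f)
  map_id U := Telescope.ind s fun k t x =>
    congrArg (fun y => Telescope.mk s U ⟨k, (t, y)⟩) ((X k).map_id U x)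
  map_comp {U V W} g f := Telescope.ind s fun k t x =>
    congrArg (fun y => Telescope.mk s W ⟨k, (t, y)⟩) ((X k).map_comp g f x)
  map_conj {U V} f := Telescope.ind s fun k t x =>
    congrArg (fun y => Telescope.mk s V ⟨k, (t, y)⟩) ((X k).map_conj f x)

end Telescope

section PolynomialApproximation

variable (p q : ℕ)

/-- The iterates `τ_{p,q}^k E`. -/
def tauIter (E : InputFunctor.{u}) : ℕ → InputFunctor.{u}
  | 0 => E
  | k + 1 => tau p q (tauIter E k)

/-- The functor `T_{p,q} E`, the homotopy colimit of
`E → τ_{p,q} E → τ_{p,q}^2 E → ⋯` along the maps `ρ_{p,q}`. -/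
def stronglyPolynomialApprox (E : InputFunctor.{u}) : InputFunctor.{u} :=
  hocolim (X := tauIter p q E) fun k => rho p q (tauIter p q E k)

end PolynomialApproximation

end C2Calculus

end

/-!
Write `X_k = τ^k E` and `T` for the telescope of the `X_k`. The maps
`ρ (τ E)` and `τ (ρ E)` from `τ E` to `τ² E` send a natural transformation `α` to
`((f, x), (g, y)) ↦ α (g f, y)` and to `((f, x), (g, y)) ↦ α (g f, g x)`. The unit vectors `g x` and
`y` are orthogonal, and both are orthogonal to the image of `g f`, so that
`α (g f, cos t · g x + sin t · y)` is a natural equivariant homotopy between the two maps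
(`SphereBundle.rotate`). It is constant on the image of `ρ E`.

The functor `τ` commutes with the telescope on compact families. The values of a family of natural
transformations `S(V, -) → T` are determined up to isometries by those on `S(V, W₀)` for one
representation `W₀` of dimension at least `dim V + p + q` (`SphereBundle.exists_post_eq`). As
`S(V, W₀)` is compact and linear isometries preserve the height in the telescope, the family has
bounded height (`exists_bound_of_invariant`). The part of `T` of height at most `N` deforms,
naturally and equivariantly, into the copy of `X_N` at height `N` (`Telescope.raise`).

By `LiftsCubes.isWeakHomotopyEquiv` it is enough to lift, up to homotopy of pairs, a map
`b : Iⁿ → τ T (V)` with a lift `a` to `T(V)` on the boundary. After a deformation `b` comes from a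
map `b₀ : Iⁿ → τ X_N (V)` and `a` from a map `a₀` to `X_N(V)`. As `τ X_N = X_{N+1}`, the map `b₀` is
also a map to the copy of `X_{N+1}(V)` in `T(V)`, and this is the lift: the cylinder of the telescope
followed by the rotation is a homotopy from `b` to its image under `ρ T`
(`pairHomotopic_cylinder`, `pairHomotopic_rotate`). All homotopies are equivariant, so the argument
applies to fixed points as well; the set `fixedIf φ` treats both cases together.
-/

namespace C2Calculus

open Topology unitInterval

noncomputable section

/-! ### A lifting criterion for weak homotopy equivalences -/

section LiftingCriterion

variable {A B : Type u} [TopologicalSpace A] [TopologicalSpace B]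

/-- Two maps `(a₀, b₀)` and `(a₁, b₁)` from a pair `L ⊆ K` to a map `f : A → B` are homotopic
through such maps, by homotopies with values in the subsets `P` of `A` and `Q` of `B`. -/
def PairHomotopic (f : A → B) (P : Set A) (Q : Set B) {K : Type} [TopologicalSpace K] {L : Set K}
    (a₀ a₁ : C(L, A)) (b₀ b₁ : C(K, B)) : Prop :=
  ∃ (h : a₀.Homotopy a₁) (H : b₀.Homotopy b₁), (∀ t (l : L), H (t, (l : K)) = f (h (t, l))) ∧
    (∀ z, h z ∈ P) ∧ ∀ z, H z ∈ Q

theorem PairHomotopic.trans {f : A → B} {P : Set A} {Q : Set B} {K : Type} [TopologicalSpace K]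
    {L : Set K} {a₀ a₁ a₂ : C(L, A)} {b₀ b₁ b₂ : C(K, B)} (h₁ : PairHomotopic f P Q a₀ a₁ b₀ b₁)
    (h₂ : PairHomotopic f P Q a₁ a₂ b₁ b₂) : PairHomotopic f P Q a₀ a₂ b₀ b₂ := by
  obtain ⟨h, H, c, hP, hQ⟩ := h₁
  obtain ⟨h', H', c', hP', hQ'⟩ := h₂
  refine ⟨h.trans h', H.trans H', fun t l => ?_, fun z => ?_, fun z => ?_⟩
  · rw [ContinuousMap.Homotopy.trans_apply, ContinuousMap.Homotopy.trans_apply]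
    split_ifs
    · exact c _ _
    · exact c' _ _
  · rw [ContinuousMap.Homotopy.trans_apply]
    split_ifs
    · exact hP _
    · exact hP' _
  · rw [ContinuousMap.Homotopy.trans_apply]
    split_ifs
    · exact hQ _
    · exact hQ' _

/-- Every map from the pair `∂Iⁿ ⊆ Iⁿ` to `f : A → B` with values in `P` and `Q` is homotopic,
through maps of the same kind, to one that comes from a map `Iⁿ → A`. -/
def LiftsCubes (f : C(A, B)) (P : Set A) (Q : Set B) : Prop :=
  ∀ (n : ℕ) (a : C(Cube.boundary (Fin n), A)) (b : C(I^ Fin n, B)),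
    (∀ l, f (a l) = b l) → (∀ l, a l ∈ P) → (∀ k, b k ∈ Q) →
    ∃ a' : C(I^ Fin n, A), (∀ k, a' k ∈ P) ∧
      PairHomotopic f P Q a (a'.restrict _) b (f.comp a')

/-- Lifting with values in subsets amounts to lifting along the restriction of `f` to them. -/
theorem LiftsCubes.restrict {f : C(A, B)} {P : Set A} {Q : Set B} (hf : LiftsCubes f P Q)
    (g : C(P, Q)) (hg : ∀ x, (g x : B) = f x) : LiftsCubes g Set.univ Set.univ := by
  intro n a b hab _ _
  obtain ⟨a', ha', h, H, c, hP, hQ⟩ := hf n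
    ((⟨Subtype.val, continuous_subtype_val⟩ : C(P, A)).comp a)
    ((⟨Subtype.val, continuous_subtype_val⟩ : C(Q, B)).comp b)
    (fun l => (hg _).symm.trans (congrArg Subtype.val (hab l))) (fun l => (a l).2)
    (fun k => (b k).2)
  refine ⟨⟨fun k => ⟨a' k, ha' k⟩, by fun_prop⟩, fun _ => trivial,
    ⟨⟨fun z => ⟨h z, hP z⟩, by fun_prop⟩, fun l => Subtype.ext ?_, fun l => Subtype.ext ?_⟩,
    ⟨⟨fun z => ⟨H z, hQ z⟩, by fun_prop⟩, fun l => Subtype.ext ?_, fun l => Subtype.ext ?_⟩,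
    fun t l => Subtype.ext ?_, fun _ => trivial, fun _ => trivial⟩
  · exact h.apply_zero l
  · exact h.apply_one l
  · exact H.apply_zero l
  · exact (H.apply_one l).trans (hg ⟨a' l, ha' l⟩).symm
  · exact (c t l).trans (hg ⟨h (t, l), hP (t, l)⟩).symm

section Radial

variable {n : ℕ}

/-- The distance of a point of the cube from the centre, normalised to be `1` on the boundary. -/
def cubeRadius (y : I^ Fin n) : ℝ := ‖fun i => 2 * (y i : ℝ) - 1‖

theorem continuous_cubeRadius : Continuous (cubeRadius : (I^ Fin n) → ℝ) := by
  unfold cubeRadius; fun_prop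

theorem abs_two_mul_sub_one_le (t : I) : |2 * (t : ℝ) - 1| ≤ 1 := by
  have := t.2.1; have := t.2.2
  rw [abs_le]; constructor <;> linarith

theorem abs_le_cubeRadius (y : I^ Fin n) (i : Fin n) : |2 * (y i : ℝ) - 1| ≤ cubeRadius y :=
  norm_le_pi_norm (fun i => 2 * (y i : ℝ) - 1) i

theorem cubeRadius_le_one (y : I^ Fin n) : cubeRadius y ≤ 1 :=
  (pi_norm_le_iff_of_nonneg zero_le_one).2 fun i => abs_two_mul_sub_one_le (y i)

theorem cubeRadius_eq_one {y : I^ Fin n} (hy : y ∈ Cube.boundary (Fin n)) : cubeRadius y = 1 := by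
  obtain ⟨i, hi⟩ := hy
  refine le_antisymm (cubeRadius_le_one y) ?_
  refine le_trans ?_ (abs_le_cubeRadius y i)
  rcases hi with h | h <;> norm_num [h]

/-- Radial dilation of the cube by the factor `1 / max (1 - s / 2) r`, where `r` is the radius of the
point. The maximum keeps the result inside the cube. -/
def dilate (z : I × I^ Fin n) : I^ Fin n := fun i =>
  Set.projIcc (0 : ℝ) 1 zero_le_one
    (((2 * (z.2 i : ℝ) - 1) / max (1 - (z.1 : ℝ) / 2) (cubeRadius z.2) + 1) / 2)

theorem dilate_denom_pos (z : I × I^ Fin n) : 0 < max (1 - (z.1 : ℝ) / 2) (cubeRadius z.2) :=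
  lt_max_of_lt_left (by have := z.1.2.2; linarith)

theorem continuous_dilate : Continuous (dilate : I × (I^ Fin n) → I^ Fin n) := by
  refine continuous_pi fun i => continuous_projIcc.comp ?_
  have h := (continuous_cubeRadius (n := n))
  refine Continuous.div_const (Continuous.add (Continuous.div (by fun_prop) (by fun_prop)
    fun z => (dilate_denom_pos z).ne') continuous_const) _

theorem dilate_of_max_eq_one {z : I × I^ Fin n}
    (h : max (1 - (z.1 : ℝ) / 2) (cubeRadius z.2) = 1) : dilate z = z.2 := by
  funext i
  have e : ((2 * (z.2 i : ℝ) - 1) / 1 + 1) / 2 = z.2 i := by ring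
  rw [dilate, h, e, Set.projIcc_val]

theorem dilate_zero (y : I^ Fin n) : dilate (0, y) = y :=
  dilate_of_max_eq_one (by simpa using cubeRadius_le_one y)

theorem dilate_boundary (s : I) {y : I^ Fin n} (hy : y ∈ Cube.boundary (Fin n)) :
    dilate (s, y) = y :=
  dilate_of_max_eq_one (by
    rw [cubeRadius_eq_one hy]
    exact max_eq_right (by have := s.2.1; dsimp only; linarith))

theorem dilate_mem_boundary {y : I^ Fin n} (hy : 1 / 2 ≤ cubeRadius y) :
    dilate (1, y) ∈ Cube.boundary (Fin n) := by
  have hpos : 0 < cubeRadius y := by linarith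
  have hm : max (1 - ((1 : I) : ℝ) / 2) (cubeRadius y) = cubeRadius y :=
    max_eq_right (by simpa using by linarith)
  obtain ⟨i, hi⟩ : ∃ i, cubeRadius y ≤ |2 * (y i : ℝ) - 1| := by
    by_contra! hc
    exact lt_irrefl _ ((pi_norm_lt_iff hpos).2 hc)
  have hi' : |2 * (y i : ℝ) - 1| = cubeRadius y := (abs_le_cubeRadius y i).antisymm hi
  refine ⟨i, ?_⟩
  rcases abs_choice (2 * (y i : ℝ) - 1) with h | h
  · right
    refine Set.projIcc_of_right_le _ ?_
    dsimp only
    rw [hm, ← h, hi', div_self hpos.ne']; norm_num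
  · left
    refine Set.projIcc_of_le_left _ ?_
    dsimp only
    rw [hm, ← neg_neg (2 * (y i : ℝ) - 1), ← h, hi', neg_div, div_self hpos.ne']; norm_num

/-- The time parameter `min s (2 - 2 r)` that accompanies `dilate`. -/
def dilateTime (z : I × I^ Fin n) : I :=
  Set.projIcc (0 : ℝ) 1 zero_le_one (min (z.1 : ℝ) (2 * (1 - cubeRadius z.2)))

theorem continuous_dilateTime : Continuous (dilateTime : I × (I^ Fin n) → I) := by
  have h := (continuous_cubeRadius (n := n))
  exact continuous_projIcc.comp (by fun_prop)

theorem dilateTime_zero (y : I^ Fin n) : dilateTime (0, y) = 0 :=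
  Set.projIcc_of_le_left _ (min_le_left _ _)

theorem dilateTime_boundary (s : I) {y : I^ Fin n} (hy : y ∈ Cube.boundary (Fin n)) :
    dilateTime (s, y) = 0 :=
  Set.projIcc_of_le_left _ ((min_le_right _ _).trans (by simp [cubeRadius_eq_one hy]))

theorem dilateTime_one {y : I^ Fin n} (hy : cubeRadius y ≤ 1 / 2) : dilateTime (1, y) = 1 :=
  Set.projIcc_of_right_le _ (le_min (by simp) (by dsimp only; linarith))

end Radial

/-- The homotopy extension property of `∂Iⁿ ⊆ Iⁿ` straightens lifts up to homotopy: the lift can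
be chosen to agree with `a` on the boundary, and the homotopy to be constant there. The homotopy
from `b` shrinks `b` to the cube of half size and lets the given homotopy run in the collar. -/
theorem LiftsCubes.exists_strict {f : C(A, B)} (hf : LiftsCubes f Set.univ Set.univ) {n : ℕ}
    (a : C(Cube.boundary (Fin n), A)) (b : C(I^ Fin n, B)) (hab : ∀ l, f (a l) = b l) :
    ∃ c : C(I^ Fin n, A), (∀ l : Cube.boundary (Fin n), c l = a l) ∧
      b.HomotopicRel (f.comp c) (Cube.boundary (Fin n)) := by
  obtain ⟨a', -, h, H, comp, -, -⟩ := hf n a b hab (fun _ => trivial) (fun _ => trivial)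
  classical
  -- the values of `h`, with junk values off the boundary
  let hext : I × (I^ Fin n) → A := fun z =>
    if hz : z.2 ∈ Cube.boundary (Fin n) then h (z.1, ⟨z.2, hz⟩) else a' z.2
  have hext_apply : ∀ (t : I) {y : I^ Fin n} (hy : y ∈ Cube.boundary (Fin n)),
      hext (t, y) = h (t, ⟨y, hy⟩) := fun t y hy => dif_pos hy
  have hcont : ContinuousOn hext {z | z.2 ∈ Cube.boundary (Fin n)} := by
    rw [continuousOn_iff_continuous_domRestrict]
    have : Continuous fun z : {z : I × (I^ Fin n) // z.2 ∈ Cube.boundary (Fin n)} =>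
        h (z.1.1, ⟨z.1.2, z.2⟩) := by fun_prop
    exact this.congr fun z => (hext_apply z.1.1 z.2).symm
  have hd : Continuous fun y : I^ Fin n => dilate (1, y) :=
    continuous_dilate.comp (by fun_prop)
  have hdt : Continuous fun y : I^ Fin n => dilateTime (1, y) :=
    continuous_dilateTime.comp (by fun_prop)
  let c : C(I^ Fin n, A) :=
    ⟨fun y => if cubeRadius y ≤ 1 / 2 then a' (dilate (1, y))
      else hext (dilateTime (1, y), dilate (1, y)), by
      refine continuous_if_le continuous_cubeRadius continuous_const
        (a'.continuous.comp hd).continuousOn ?_ ?_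
      · exact hcont.comp (hdt.prodMk hd).continuousOn fun y hy => dilate_mem_boundary hy
      · intro y hy
        rw [hext_apply _ (dilate_mem_boundary hy.ge), dilateTime_one hy.le]
        exact (h.apply_one ⟨_, dilate_mem_boundary hy.ge⟩).symm⟩
  have hc : ∀ y, f (c y) = H (dilateTime (1, y), dilate (1, y)) := by
    intro y
    change f (if cubeRadius y ≤ 1 / 2 then _ else _) = _
    by_cases hy : cubeRadius y ≤ 1 / 2
    · rw [if_pos hy, dilateTime_one hy]
      exact (H.apply_one _).symm
    · rw [if_neg hy]
      refine (congrArg f (hext_apply _ (dilate_mem_boundary (not_le.1 hy).le))).trans ?_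
      exact (comp _ ⟨_, dilate_mem_boundary (not_le.1 hy).le⟩).symm
  refine ⟨c, ?_, ⟨⟨⟨⟨fun z => H (dilateTime z, dilate z),
    H.continuous.comp (continuous_dilateTime.prodMk continuous_dilate)⟩, fun y => ?_, fun y => ?_⟩,
    fun t y hy => ?_⟩⟩⟩
  · rintro ⟨y, hy⟩
    change (if cubeRadius y ≤ 1 / 2 then _ else _) = _
    rw [if_neg (by rw [cubeRadius_eq_one hy]; norm_num)]
    refine (hext_apply _ (dilate_mem_boundary (by rw [cubeRadius_eq_one hy]; norm_num))).trans ?_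
    simp only [dilateTime_boundary _ hy, dilate_boundary _ hy]
    exact h.apply_zero _
  · change H (dilateTime (0, y), dilate (0, y)) = b y
    rw [dilateTime_zero, dilate_zero]
    exact H.apply_zero _
  · exact (hc y).symm
  · change H (dilateTime (t, y), dilate (t, y)) = b y
    rw [dilateTime_boundary _ hy, dilate_boundary _ hy]
    exact H.apply_zero _

theorem LiftsCubes.surjective_piMap {f : C(A, B)} (hf : LiftsCubes f Set.univ Set.univ) (n : ℕ)
    (x : A) : Function.Surjective (piMap f n x) := by
  intro β
  induction β using Quotient.ind with
  | _ β =>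
    obtain ⟨c, hc, hb⟩ := hf.exists_strict (.const _ x) β.1 fun l => (β.2 l l.2).symm
    exact ⟨Quotient.mk _ ⟨c, fun y hy => hc ⟨y, hy⟩⟩, Quotient.sound hb.symm⟩

/-- A homotopy between the images of two loops is a map on a cube of one dimension more, which
lifts on the boundary. -/
theorem LiftsCubes.injective_piMap {f : C(A, B)} (hf : LiftsCubes f Set.univ Set.univ) (n : ℕ)
    (x : A) : Function.Injective (piMap f n x) := by
  intro α β hαβ
  induction α using Quotient.ind with
  | _ α =>
  induction β using Quotient.ind with
  | _ β =>
    obtain ⟨F⟩ := Quotient.exact hαβ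
    have htail : Continuous fun y : I^ Fin (n + 1) => (Fin.tail y : I^ Fin n) :=
      continuous_pi fun i => continuous_apply _
    let b : C(I^ Fin (n + 1), B) := ⟨fun y => F (y 0, Fin.tail y), by fun_prop⟩
    have hbd : ∀ {y : I^ Fin (n + 1)}, y ∈ Cube.boundary (Fin (n + 1)) → y 0 ≠ 0 → y 0 ≠ 1 →
        (Fin.tail y : I^ Fin n) ∈ Cube.boundary (Fin n) := by
      rintro y ⟨i, hi⟩ h0 h1
      induction i using Fin.cases with
      | zero => exact absurd hi (by tauto)
      | succ i => exact ⟨i, hi⟩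
    have ne0 : ∀ {t : I}, 1 / 2 ≤ (t : ℝ) → t ≠ 0 := by
      rintro _ h rfl; norm_num at h
    have ne1 : ∀ {t : I}, (t : ℝ) ≤ 1 / 2 → t ≠ 1 := by
      rintro _ h rfl; norm_num at h
    -- off the two end faces both branches are constant at `x`, so that the cut can be at `1 / 2`
    let a : C(Cube.boundary (Fin (n + 1)), A) :=
      ⟨fun y => if (y.1 0 : ℝ) ≤ 1 / 2 then α (Fin.tail y.1) else β (Fin.tail y.1), by
        refine continuous_if_le (continuous_subtype_val.comp
          ((continuous_apply 0).comp continuous_subtype_val)) continuous_const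
          (α.1.continuous.comp (htail.comp continuous_subtype_val)).continuousOn
          (β.1.continuous.comp (htail.comp continuous_subtype_val)).continuousOn fun y hy => ?_
        have h := hbd y.2 (ne0 hy.ge) (ne1 hy.le)
        exact (α.2 _ h).trans (β.2 _ h).symm⟩
    have a_le : ∀ y, ((y.1 0 : I) : ℝ) ≤ 1 / 2 → a y = α (Fin.tail y.1) := fun y h => if_pos h
    have a_gt : ∀ y, ¬ ((y.1 0 : I) : ℝ) ≤ 1 / 2 → a y = β (Fin.tail y.1) := fun y h => if_neg h
    have hF : ∀ t {y : I^ Fin n}, y ∈ Cube.boundary (Fin n) → F (t, y) = f x := fun t y hy =>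
      (F.eq_fst t hy).trans (congrArg f (α.2 y hy))
    obtain ⟨c, hc, -⟩ := hf.exists_strict a b fun y => by
      change _ = F (y.1 0, Fin.tail y.1)
      by_cases hy : (y.1 0 : ℝ) ≤ 1 / 2
      · rw [a_le y hy]
        by_cases h0 : y.1 0 = 0
        · rw [h0]
          exact (F.apply_zero _).symm
        · have h := hbd y.2 h0 (ne1 hy)
          rw [hF _ h]
          exact congrArg f (α.2 _ h)
      · rw [a_gt y hy]
        by_cases h1 : y.1 0 = 1
        · rw [h1]
          exact (F.apply_one _).symm
        · have h := hbd y.2 (ne0 (not_le.1 hy).le) h1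
          rw [hF _ h]
          exact congrArg f (β.2 _ h)
    have hcons : Continuous fun z : I × (I^ Fin n) => (Fin.cons z.1 z.2 : I^ Fin (n + 1)) := by
      refine continuous_pi fun i => ?_
      induction i using Fin.cases with
      | zero => exact continuous_fst
      | succ i => exact (continuous_apply i).comp continuous_snd
    refine Quotient.sound ⟨⟨⟨⟨fun z => c (Fin.cons z.1 z.2 : I^ Fin (n + 1)), by fun_prop⟩,
      fun y => ?_, fun y => ?_⟩, fun t y hy => ?_⟩⟩
    · exact (hc ⟨(Fin.cons 0 y : I^ Fin (n + 1)), 0, Or.inl rfl⟩).trans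
        (a_le _ (by simp))
    · exact (hc ⟨(Fin.cons 1 y : I^ Fin (n + 1)), 0, Or.inr rfl⟩).trans
        (a_gt _ (by norm_num))
    · have hmem : (Fin.cons t y : I^ Fin (n + 1)) ∈ Cube.boundary (Fin (n + 1)) := by
        obtain ⟨i, hi⟩ := hy
        exact ⟨i.succ, hi⟩
      refine (hc ⟨_, hmem⟩).trans ?_
      change _ = α y
      by_cases ht : (t : ℝ) ≤ 1 / 2
      · exact a_le _ ht
      · exact (a_gt _ ht).trans ((β.2 y hy).trans (α.2 y hy).symm)

/-- A map along which maps of pairs `∂Iⁿ ⊆ Iⁿ` lift up to homotopy is a weak homotopy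
equivalence. -/
theorem LiftsCubes.isWeakHomotopyEquiv {f : C(A, B)} (hf : LiftsCubes f Set.univ Set.univ) :
    IsWeakHomotopyEquiv f := by
  have hpi : ∀ n x, Function.Bijective (piMap f n x) := fun n x =>
    ⟨hf.injective_piMap n x, hf.surjective_piMap n x⟩
  have hsq : ∀ (x : A) (α : HomotopyGroup (Fin 0) A x),
      pi0Map f (HomotopyGroup.pi0EquivZerothHomotopy α) =
        HomotopyGroup.pi0EquivZerothHomotopy (piMap f 0 x α) := by
    intro x α
    induction α using Quotient.ind
    rfl
  refine ⟨⟨fun u v huv => ?_, fun w => ?_⟩, hpi⟩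
  · induction u using Quotient.ind with
    | _ x =>
      obtain ⟨α, hα⟩ := (HomotopyGroup.pi0EquivZerothHomotopy (x := x)).surjective ⟦x⟧
      obtain ⟨β, rfl⟩ := (HomotopyGroup.pi0EquivZerothHomotopy (x := x)).surjective v
      rw [← hα] at huv ⊢
      rw [hsq, hsq, EmbeddingLike.apply_eq_iff_eq] at huv
      rw [(hpi 0 x).1 huv]
  · induction w using Quotient.ind with
    | _ y =>
      have hempty : IsEmpty (Cube.boundary (Fin 0)) := ⟨fun l => l.2.choose.elim0⟩
      obtain ⟨c, -, ⟨H⟩⟩ := hf.exists_strict (n := 0) ⟨isEmptyElim, by fun_prop⟩ (.const _ y)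
        isEmptyElim
      exact ⟨⟦c 0⟧, Quotient.sound ⟨(H.toHomotopy.evalAt 0).symm⟩⟩

end LiftingCriterion

/-! ### Isometries of finite-dimensional inner product spaces -/

section LinearAlgebra

open Module

/-- An isometry into the image of a second one factors through it. -/
theorem exists_comp_eq_of_range_le {A B C : Type*} [NormedAddCommGroup A] [InnerProductSpace ℝ A]
    [NormedAddCommGroup B] [InnerProductSpace ℝ B] [NormedAddCommGroup C] [InnerProductSpace ℝ C]
    (g : A →ₗᵢ[ℝ] B) (f : C →ₗᵢ[ℝ] B)
    (h : LinearMap.range f.toLinearMap ≤ LinearMap.range g.toLinearMap) :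
    ∃ f' : C →ₗᵢ[ℝ] A, g.comp f' = f := by
  let k : C →ₗ[ℝ] A := g.equivRange.symm.toLinearEquiv.toLinearMap ∘ₗ
    f.toLinearMap.codRestrict _ fun c => h ⟨c, rfl⟩
  have hk : ∀ c, g (k c) = f c := fun c =>
    congrArg Subtype.val (g.equivRange.apply_symm_apply ⟨f c, h ⟨c, rfl⟩⟩)
  exact ⟨⟨k, fun c => by rw [← g.norm_map, hk, f.norm_map]⟩, LinearIsometry.ext hk⟩

variable {A B : Type*} [NormedAddCommGroup A] [InnerProductSpace ℝ A] [FiniteDimensional ℝ A]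
  [NormedAddCommGroup B] [InnerProductSpace ℝ B] [FiniteDimensional ℝ B]

theorem nonempty_linearIsometry (h : finrank ℝ A ≤ finrank ℝ B) : Nonempty (A →ₗᵢ[ℝ] B) := by
  let v := stdOrthonormalBasis ℝ A
  let w := stdOrthonormalBasis ℝ B
  let c : Fin (finrank ℝ A) → B := fun i => w (Fin.castLE h i)
  have hc : Orthonormal ℝ c := w.orthonormal.comp _ (Fin.castLE_injective h)
  refine ⟨(v.toBasis.constr ℝ c).isometryOfOrthonormal (v := v.toBasis) ?_ ?_⟩
  · rw [v.coe_toBasis]; exact v.orthonormal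
  · convert hc using 1
    ext i
    simp

/-- Every subspace of dimension at most `dim A` lies in the image of an isometry `A → B`. -/
theorem exists_linearIsometry_le_range (h : finrank ℝ A ≤ finrank ℝ B) (S : Submodule ℝ B)
    (hS : finrank ℝ S ≤ finrank ℝ A) :
    ∃ g : A →ₗᵢ[ℝ] B, S ≤ LinearMap.range g.toLinearMap := by
  obtain ⟨g⟩ := nonempty_linearIsometry h
  obtain ⟨i⟩ := nonempty_linearIsometry hS
  -- an isometry of `B` that moves `S` into the image of `g`
  let e : B ≃ₗᵢ[ℝ] B := (g.comp i).extend.toLinearIsometryEquiv rfl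
  refine ⟨e.symm.toLinearIsometry.comp g, fun x hx => ⟨i ⟨x, hx⟩, ?_⟩⟩
  change e.symm (g (i ⟨x, hx⟩)) = x
  rw [LinearIsometryEquiv.symm_apply_eq]
  exact ((g.comp i).extend_apply ⟨x, hx⟩).symm

theorem exists_rep_le_finrank (n : ℕ) : ∃ W : Rep, n ≤ finrank ℝ W := by
  let J : Set (ℕ × Bool) := {j | j.1 < n}
  have hJ : J.Finite := ((Set.finite_lt_nat n).prod Set.finite_univ).subset
    fun j hj => ⟨hj, trivial⟩
  have : Fintype J := hJ.fintype
  let S : Submodule ℝ RegSum := Finsupp.supported ℝ ℝ J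
  let e : S ≃ₗ[ℝ] (J →₀ ℝ) := Finsupp.supportedEquivFinsupp J
  refine ⟨⟨S, e.symm.finiteDimensional, fun x hx => ?_⟩, ?_⟩
  · have hx' := (Finsupp.mem_supported' ℝ x.coord).1 hx
    refine (Finsupp.mem_supported' ℝ (RegSum.sigma x).coord).2 ?_
    rintro ⟨m, b⟩ hm
    rw [RegSum.sigma_coord]
    exact hx' _ hm
  · change n ≤ finrank ℝ S
    rw [e.finrank_eq, finrank_finsupp_self]
    refine le_trans (Fintype.card_fin n).ge (Fintype.card_le_of_injective
      (fun i : Fin n => (⟨(i, true), i.2⟩ : J)) fun i j hij => ?_)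
    simpa [Fin.ext_iff] using hij

end LinearAlgebra

/-! ### Generation of the sphere bundle functor by one value -/

section SphereBundle

open Module

variable {p q : ℕ}

instance (V W : Rep) : CompactSpace (SphereBundle p q V W) := by
  have hcl : IsClosed {z : (V →ₗᵢ[ℝ] W) × (Fin p ⊕ Fin q → W) |
    (∀ i, z.2 i ∈ (LinearMap.range z.1.toLinearMap)ᗮ) ∧ ∑ i, ‖z.2 i‖ ^ 2 = 1} := by
    simp only [mem_range_perp]
    refine IsClosed.and ?_ (isClosed_eq (by fun_prop) continuous_const)
    simp only [Set.ofPred_forall]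
    refine isClosed_iInter fun i => isClosed_iInter fun v => isClosed_eq ?_ continuous_const
    have h : Continuous fun z : (V →ₗᵢ[ℝ] W) × (Fin p ⊕ Fin q → W) => z.1 v :=
      continuous_isometry_apply.comp (continuous_fst.prodMk continuous_const)
    fun_prop
  have : ProperSpace (Fin p ⊕ Fin q → W) := FiniteDimensional.proper ℝ _
  refine isCompact_iff_compactSpace.1 ((isCompact_univ.prod
    (isCompact_closedBall (0 : Fin p ⊕ Fin q → W) 1)).of_isClosed_subset hcl ?_)
  rintro ⟨f, x⟩ ⟨-, hx⟩
  refine ⟨trivial, ?_⟩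
  rw [mem_closedBall_zero_iff, pi_norm_le_iff_of_nonneg zero_le_one]
  intro i
  have h : ‖x i‖ ^ 2 ≤ 1 :=
    (Finset.single_le_sum (f := fun i => ‖x i‖ ^ 2) (fun _ _ => sq_nonneg _)
      (Finset.mem_univ i)).trans hx.le
  exact (sq_le_one_iff₀ (norm_nonneg _)).1 h

instance (V W : Rep) : T2Space (SphereBundle p q V W) :=
  inferInstanceAs (T2Space (Subtype _))

/-- The sphere bundle functor `S(V, -)` is generated by its value at any representation of
dimension at least `dim V + p + q`: the image of `f` and the components of `x` span a subspace of at
most this dimension. -/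
theorem SphereBundle.exists_post_eq {V W₀ W : Rep} (h₀ : finrank ℝ V + (p + q) ≤ finrank ℝ W₀)
    (hW : finrank ℝ W₀ ≤ finrank ℝ W) (z : SphereBundle p q V W) :
    ∃ (g : W₀ →ₗᵢ[ℝ] W) (z₀ : SphereBundle p q V W₀), z₀.post g = z := by
  let R := LinearMap.range z.1.1.toLinearMap
  let S := Submodule.span ℝ (Set.range z.1.2)
  have hS : finrank ℝ S ≤ p + q :=
    (finrank_range_le_card z.1.2).trans (by simp)
  have hR : finrank ℝ R = finrank ℝ V := LinearMap.finrank_range_of_inj z.1.1.injective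
  obtain ⟨g, hg⟩ := exists_linearIsometry_le_range hW (R ⊔ S)
    ((Submodule.finrank_add_le_finrank_add_finrank R S).trans (by omega))
  obtain ⟨f, hf⟩ := exists_comp_eq_of_range_le g z.1.1 (le_sup_left.trans hg)
  choose x hx using fun i =>
    hg (le_sup_right (a := R) (Submodule.subset_span ⟨i, rfl⟩ : z.1.2 i ∈ S))
  have hx' : ∀ i, g (x i) = z.1.2 i := hx
  refine ⟨g, ⟨(f, x), fun i => ?_, ?_⟩, SphereBundle.ext hf hx⟩
  · rw [mem_range_perp]
    intro v
    have hv : g (f v) = z.1.1 v := DFunLike.congr_fun hf v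
    change inner ℝ (f v) (x i) = 0
    rw [← g.inner_map_map, hx', hv]
    exact mem_range_perp.1 (z.2.1 i) v
  · rw [← z.2.2]
    exact Finset.sum_congr rfl fun i _ => by rw [← hx', g.norm_map]

/-- A continuous function on the values of `E` that is invariant under the action of linear
isometries is bounded on a compact family of natural transformations `S(V, -)₊ → E`. -/
theorem exists_bound_of_invariant {E : InputFunctor.{u}} {V : Rep} {K : Type} [TopologicalSpace K]
    [CompactSpace K] (b : K → NatTransf p q E V) (hb : Continuous b) (ht : ∀ W, E.obj W → ℝ)
    (hc : ∀ W, Continuous (ht W))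
    (hinv : ∀ {W W' : Rep} (h : W →ₗᵢ[ℝ] W') x, ht W' (E.map h x) = ht W x) :
    ∃ C, ∀ k W z, ht W ((b k).1 W z) ≤ C := by
  obtain ⟨W₀, h₀⟩ := exists_rep_le_finrank (finrank ℝ V + (p + q))
  have hcont : Continuous fun y : K × SphereBundle p q V W₀ => ht W₀ ((b y.1).1 W₀ y.2) :=
    (hc W₀).comp (ContinuousEval.continuous_eval.comp
      (((NatTransf.continuous_component W₀).comp (hb.comp continuous_fst)).prodMk continuous_snd))
  obtain ⟨C, hC⟩ := (isCompact_range hcont).bddAbove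
  refine ⟨C, fun k W z => ?_⟩
  -- `W` may be too small to receive `W₀`, but it embeds into a `W'` that is not
  obtain ⟨W', hW'⟩ := exists_rep_le_finrank (max (finrank ℝ W) (finrank ℝ W₀))
  obtain ⟨h⟩ := nonempty_linearIsometry ((le_max_left _ _).trans hW')
  obtain ⟨g, z₀, hz⟩ := SphereBundle.exists_post_eq h₀ ((le_max_right _ _).trans hW') (z.post h)
  rw [← hinv h, ← (b k).2, ← hz, (b k).2, hinv]
  exact hC ⟨(k, z₀), rfl⟩

end SphereBundle

/-! ### Deforming the mapping telescope -/

section Telescope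

variable {X : ℕ → InputFunctor.{u}} {s : ∀ k, (X k).Hom (X (k + 1))}

/-- The upward path in the telescope that passes through the point `x` of `X_k(V)`, parametrised by
height. It is defined for heights between `k` and `k + d + 1`, and constant on either side. The
recursion runs through the cylinders `k, …, k + d`. -/
def Telescope.ray (s : ∀ k, (X k).Hom (X (k + 1))) (V : Rep) :
    ℕ → ∀ k : ℕ, (X k).obj V → ℝ → Telescope s V
  | 0, k, x, v => Telescope.mk s V ⟨k, (Set.projIcc (0 : ℝ) 1 zero_le_one (v - k), x)⟩
  | d + 1, k, x, v =>
    if v ≤ k + 1 then Telescope.mk s V ⟨k, (Set.projIcc (0 : ℝ) 1 zero_le_one (v - k), x)⟩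
    else Telescope.ray s V d (k + 1) (((s k).app V).toFun x) v

theorem Telescope.ray_of_le {V : Rep} (d : ℕ) {k : ℕ} (x : (X k).obj V) {v : ℝ}
    (hv : v ≤ k + 1) : Telescope.ray s V d k x v =
      Telescope.mk s V ⟨k, (Set.projIcc (0 : ℝ) 1 zero_le_one (v - k), x)⟩ := by
  cases d with
  | zero => rfl
  | succ d => exact if_pos hv

theorem Telescope.ray_add {V : Rep} (d : ℕ) {k : ℕ} (x : (X k).obj V) (t : I) :
    Telescope.ray s V d k x (k + t) = Telescope.mk s V ⟨k, (t, x)⟩ := by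
  rw [Telescope.ray_of_le _ _ (by have := t.2.2; linarith), add_sub_cancel_left, Set.projIcc_val]

theorem Telescope.continuous_mk_cylinder (V : Rep) (k : ℕ) :
    Continuous fun z : I × (X k).obj V => Telescope.mk s V ⟨k, z⟩ :=
  (Telescope.isQuotientMap_mk s V).continuous.comp continuous_sigmaMk

theorem Telescope.ray_succ_of_le {V : Rep} (d : ℕ) {k : ℕ} (x : (X k).obj V) {v : ℝ}
    (hv : (k : ℝ) + 1 ≤ v) : Telescope.ray s V (d + 1) k x v =
      Telescope.ray s V d (k + 1) (((s k).app V).toFun x) v := by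
  rcases hv.eq_or_lt with rfl | h
  · have h₁ := Telescope.ray_add (s := s) (d + 1) x 1
    have h₂ := Telescope.ray_add (s := s) d (((s k).app V).toFun x) 0
    rw [Set.Icc.coe_one] at h₁
    rw [Set.Icc.coe_zero, add_zero, Nat.cast_add, Nat.cast_one] at h₂
    rw [h₁, h₂, Telescope.glue]
  · exact if_neg (not_le.2 h)

theorem Telescope.continuous_ray (V : Rep) (d k : ℕ) :
    Continuous fun z : (X k).obj V × ℝ => Telescope.ray s V d k z.1 z.2 := by
  have h0 : ∀ k, Continuous fun z : (X k).obj V × ℝ =>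
      Telescope.mk s V ⟨k, (Set.projIcc (0 : ℝ) 1 zero_le_one (z.2 - k), z.1)⟩ := fun k =>
    (Telescope.continuous_mk_cylinder V k).comp
      ((continuous_projIcc.comp (by fun_prop)).prodMk continuous_fst)
  induction d generalizing k with
  | zero => exact h0 k
  | succ d ih =>
    refine Continuous.if_le (h0 k) ((ih (k + 1)).comp
      ((((s k).app V).continuous_toFun.comp continuous_fst).prodMk continuous_snd))
      continuous_snd continuous_const fun z hz => ?_
    rw [← Telescope.ray_of_le (d + 1) z.1 hz.le]
    exact Telescope.ray_succ_of_le d z.1 hz.ge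

theorem Telescope.ray_top {V : Rep} (d k : ℕ) (x : (X k).obj V) :
    Telescope.ray s V d k x (k + d : ℕ) =
      Telescope.mk s V ⟨k + d, (0, push s V (Nat.le_add_right k d) x)⟩ := by
  obtain ⟨n, hn⟩ : ∃ n, n = k + d := ⟨_, rfl⟩
  have key : ∀ h : k ≤ n, Telescope.ray s V d k x n =
      Telescope.mk s V ⟨n, (0, push s V h x)⟩ := by
    induction d generalizing k with
    | zero =>
      obtain rfl : n = k := hn
      intro h
      have := Telescope.ray_add (s := s) 0 x 0
      rw [Set.Icc.coe_zero, add_zero] at this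
      rw [this, push_self]
    | succ d ih =>
      intro h
      have hk : k + 1 ≤ n := by omega
      rw [Telescope.ray_succ_of_le _ _ (by exact_mod_cast hk),
        ih (k + 1) _ (by omega) hk, push_left]
  subst hn
  exact key _

/-- The deformation of the telescope that at time `t` moves every point of height less than `t N` up
to height `t N`. -/
def Telescope.raise (s : ∀ k, (X k).Hom (X (k + 1))) (V : Rep) (N : ℕ) (t : I) :
    Telescope s V → Telescope s V :=
  Telescope.lift s (fun k u x => Telescope.ray s V (N - k) k x (max (k + u) (t * N))) (by
    intro k x
    have ht : (t : ℝ) * N ≤ N := mul_le_of_le_one_left (Nat.cast_nonneg N) t.2.2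
    have e : ((k + 1 : ℕ) : ℝ) + ((0 : I) : ℝ) = k + ((1 : I) : ℝ) := by simp
    rw [e]
    have h1 : (k : ℝ) + 1 ≤ max (k + ((1 : I) : ℝ)) (t * N) := by simp
    obtain hk | hk := Nat.lt_or_ge k N
    · obtain ⟨d, hd⟩ := Nat.exists_eq_add_of_lt hk
      rw [show N - k = d + 1 by omega, show N - (k + 1) = d by omega,
        Telescope.ray_succ_of_le _ _ h1]
    · have hk' : (N : ℝ) ≤ k := by exact_mod_cast hk
      rw [max_eq_left (by simpa using by linarith), Telescope.ray_add, ← e, Telescope.ray_add,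
        Telescope.glue])

theorem Telescope.raise_mk {V : Rep} (N : ℕ) (t : I) (k : ℕ) (u : I) (x : (X k).obj V) :
    Telescope.raise s V N t (Telescope.mk s V ⟨k, (u, x)⟩) =
      Telescope.ray s V (N - k) k x (max (k + u) (t * N)) := rfl

theorem Telescope.continuous_raise (V : Rep) (N : ℕ) :
    Continuous fun z : I × Telescope s V => Telescope.raise s V N z.1 z.2 := by
  have hc : ∀ k, Continuous fun z : (I × (X k).obj V) × I =>
      Telescope.raise s V N z.2 (Telescope.mk s V ⟨k, z.1⟩) := fun k =>
    (Telescope.continuous_ray V (N - k) k).comp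
      ((continuous_snd.comp continuous_fst).prodMk
        (show Continuous fun z : (I × (X k).obj V) × I => max ((k : ℝ) + z.1.1) (z.2 * N) by
          fun_prop))
  -- the interval is locally compact, so that it is enough to treat the adjoint map on cylinders
  let F : Telescope s V → C(I, Telescope s V) := fun a =>
    ⟨fun t => Telescope.raise s V N t a, by
      induction a using Telescope.ind with
      | h k u x => exact (hc k).comp (f := fun t : I => ((u, x), t)) (by fun_prop)⟩
  have hF : Continuous F := by
    refine (Telescope.isQuotientMap_mk s V).continuous_iff.2 (continuous_sigma fun k => ?_)
    exact ContinuousMap.continuous_of_continuous_uncurry _ (hc k)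
  have h : Continuous fun z : I × Telescope s V => F z.2 z.1 := by fun_prop
  exact h

theorem Telescope.raise_zero {V : Rep} (N : ℕ) (a : Telescope s V) :
    Telescope.raise s V N 0 a = a := by
  induction a using Telescope.ind with
  | h k u x =>
    rw [Telescope.raise_mk, Set.Icc.coe_zero, zero_mul,
      max_eq_left (by have := u.2.1; positivity), Telescope.ray_add]

/-- At time `1` the part of height at most `N` has been moved to the copy of `X_N(V)` at
height `N`. -/
theorem Telescope.raise_one {V : Rep} (N : ℕ) {a : Telescope s V}
    (ha : Telescope.height s V a ≤ N) :
    Telescope.raise s V N 1 a = Telescope.mk s V ⟨N, (0, Telescope.retract s V N a)⟩ := by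
  obtain ⟨k, u, x, -, rfl⟩ := Telescope.exists_rep s V a
  have ha' : (k : ℝ) + u ≤ N := ha
  have hk : k ≤ N := by
    have := u.2.1
    exact_mod_cast (by linarith : (k : ℝ) ≤ N)
  rw [Telescope.raise_mk, Telescope.retract_mk s V hk (by linarith), Set.Icc.coe_one, one_mul,
    max_eq_right ha']
  obtain ⟨d, rfl⟩ := Nat.exists_eq_add_of_le hk
  rw [Nat.add_sub_cancel_left, Telescope.ray_top]

/-! Maps `φ k` that commute with the structure maps induce a map `Φ` of telescopes. Both linear
isometries and the action of `σ` give such families, so that it is enough to check once that `push`,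
`ray`, `raise` and `retract` commute with them. -/

theorem push_comm {V W : Rep} {φ : ∀ k, (X k).obj V → (X k).obj W}
    (hφ : ∀ k x, φ (k + 1) (((s k).app V).toFun x) = ((s k).app W).toFun (φ k x))
    {k n : ℕ} (h : k ≤ n) (x : (X k).obj V) : φ n (push s V h x) = push s W h (φ k x) := by
  obtain ⟨d, hd⟩ := Nat.exists_eq_add_of_le h
  induction d generalizing k with
  | zero =>
    obtain rfl : n = k := hd
    rw [push_self, push_self]
  | succ d ih =>
    have hk : k + 1 ≤ n := by omega
    rw [← push_left s V hk, ← push_left s W hk, ih hk _ (by omega), hφ]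

theorem Telescope.ray_comm {V W : Rep} {φ : ∀ k, (X k).obj V → (X k).obj W}
    (hφ : ∀ k x, φ (k + 1) (((s k).app V).toFun x) = ((s k).app W).toFun (φ k x))
    {Φ : Telescope s V → Telescope s W}
    (hΦ : ∀ k t x, Φ (Telescope.mk s V ⟨k, (t, x)⟩) = Telescope.mk s W ⟨k, (t, φ k x)⟩)
    (d k : ℕ) (x : (X k).obj V) (v : ℝ) :
    Φ (Telescope.ray s V d k x v) = Telescope.ray s W d k (φ k x) v := by
  induction d generalizing k with
  | zero => exact hΦ _ _ _
  | succ d ih =>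
    rcases le_total v (k + 1) with h | h
    · rw [Telescope.ray_of_le _ _ h, Telescope.ray_of_le _ _ h, hΦ]
    · rw [Telescope.ray_succ_of_le _ _ h, Telescope.ray_succ_of_le _ _ h, ih, hφ]

theorem Telescope.raise_comm {V W : Rep} {φ : ∀ k, (X k).obj V → (X k).obj W}
    (hφ : ∀ k x, φ (k + 1) (((s k).app V).toFun x) = ((s k).app W).toFun (φ k x))
    {Φ : Telescope s V → Telescope s W}
    (hΦ : ∀ k t x, Φ (Telescope.mk s V ⟨k, (t, x)⟩) = Telescope.mk s W ⟨k, (t, φ k x)⟩)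
    (N : ℕ) (t : I) (a : Telescope s V) :
    Φ (Telescope.raise s V N t a) = Telescope.raise s W N t (Φ a) := by
  induction a using Telescope.ind with
  | h k u x => rw [hΦ, Telescope.raise_mk, Telescope.raise_mk, Telescope.ray_comm hφ hΦ]

theorem Telescope.retract_comm {V W : Rep} {φ : ∀ k, (X k).obj V → (X k).obj W}
    (hφ : ∀ k x, φ (k + 1) (((s k).app V).toFun x) = ((s k).app W).toFun (φ k x))
    {Φ : Telescope s V → Telescope s W}
    (hΦ : ∀ k t x, Φ (Telescope.mk s V ⟨k, (t, x)⟩) = Telescope.mk s W ⟨k, (t, φ k x)⟩)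
    {N : ℕ} {a : Telescope s V} (ha : Telescope.height s V a ≤ N) :
    φ N (Telescope.retract s V N a) = Telescope.retract s W N (Φ a) := by
  obtain ⟨k, u, x, -, rfl⟩ := Telescope.exists_rep s V a
  have ha' : (k : ℝ) + u ≤ N := ha
  have hk : k ≤ N := by
    have := u.2.1
    exact_mod_cast (by linarith : (k : ℝ) ≤ N)
  rw [hΦ, Telescope.retract_mk s V hk (by linarith), Telescope.retract_mk s W hk (by linarith),
    push_comm hφ]

theorem Telescope.map_raise {V W : Rep} (f : V →ₗᵢ[ℝ] W) (N : ℕ) (t : I) (a : Telescope s V) :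
    (hocolim s).map f (Telescope.raise s V N t a) =
      Telescope.raise s W N t ((hocolim s).map f a) :=
  Telescope.raise_comm (φ := fun k => (X k).map f) (fun k x => ((s k).naturality f x).symm)
    (Φ := (hocolim s).map f) (fun _ _ _ => rfl) N t a

theorem Telescope.sigma_raise {V : Rep} (N : ℕ) (t : I) (a : Telescope s V) :
    ((hocolim s).obj V).sigma (Telescope.raise s V N t a) =
      Telescope.raise s V N t (((hocolim s).obj V).sigma a) :=
  Telescope.raise_comm (φ := fun k => ((X k).obj V).sigma)
    (fun k x => (((s k).app V).map_sigma x).symm)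
    (Φ := ((hocolim s).obj V).sigma) (fun _ _ _ => rfl) N t a

theorem Telescope.map_retract {V W : Rep} (f : V →ₗᵢ[ℝ] W) {N : ℕ} {a : Telescope s V}
    (ha : Telescope.height s V a ≤ N) :
    (X N).map f (Telescope.retract s V N a) =
      Telescope.retract s W N ((hocolim s).map f a) :=
  Telescope.retract_comm (φ := fun k => (X k).map f) (fun k x => ((s k).naturality f x).symm)
    (Φ := (hocolim s).map f) (fun _ _ _ => rfl) ha

theorem Telescope.sigma_retract {V : Rep} {N : ℕ} {a : Telescope s V}
    (ha : Telescope.height s V a ≤ N) :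
    ((X N).obj V).sigma (Telescope.retract s V N a) =
      Telescope.retract s V N (((hocolim s).obj V).sigma a) :=
  Telescope.retract_comm (φ := fun k => ((X k).obj V).sigma)
    (fun k x => (((s k).app V).map_sigma x).symm)
    (Φ := ((hocolim s).obj V).sigma) (fun _ _ _ => rfl) ha

theorem Telescope.height_map {V W : Rep} (f : V →ₗᵢ[ℝ] W) (a : Telescope s V) :
    Telescope.height s W ((hocolim s).map f a) = Telescope.height s V a := by
  induction a using Telescope.ind with
  | h k u x => rfl

end Telescope

/-! ### Maps into the functor of natural transformations -/

section TauMaps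

variable {p q : ℕ} {E : InputFunctor.{u}} {V : Rep} {K : Type} [TopologicalSpace K]

/-- The value of a point of `τ_{p,q} E (V)`, a natural transformation, at a point of the sphere
bundle. -/
def tauEval (α : (tau p q E).obj V) {W : Rep} (z : SphereBundle p q V W) : E.obj W := α.val.1 W z

theorem tau_ext {α β : (tau p q E).obj V}
    (h : ∀ W (z : SphereBundle p q V W), tauEval α z = tauEval β z) : α = β :=
  Kify.ext (NatTransf.ext h)

theorem tauEval_post (α : (tau p q E).obj V) {W W' : Rep} (g : W →ₗᵢ[ℝ] W')
    (z : SphereBundle p q V W) : tauEval α (z.post g) = E.map g (tauEval α z) := α.val.2 W W' g z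

theorem tauEval_sigma (α : (tau p q E).obj V) {W : Rep} (z : SphereBundle p q V W) :
    tauEval (((tau p q E).obj V).sigma α) z = (E.obj W).sigma (tauEval α z.sigma) := rfl

theorem tauEval_rho (x : E.obj V) {W : Rep} (z : SphereBundle p q V W) :
    tauEval (((rho p q E).app V).toFun x) z = E.map z.1.1 x := rfl

theorem tauEval_map {V' : Rep} (g : V →ₗᵢ[ℝ] V') (α : (tau p q E).obj V) {W : Rep}
    (z : SphereBundle p q V' W) : tauEval ((tau p q E).map g α) z = tauEval α (z.pre g) := rfl

theorem continuous_tauEval (W : Rep) : Continuous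
    fun y : (tau p q E).obj V × SphereBundle p q V W => tauEval y.1 y.2 :=
  ContinuousEval.continuous_eval.comp (((NatTransf.continuous_component W).comp
    (Kify.continuous_val.comp continuous_fst)).prodMk continuous_snd)

variable [CompactSpace K] [T2Space K]

/-- A compact family of natural transformations from the sphere bundle functor, given by its
adjoint maps. Compactness makes the family continuous for the compactly generated topology. -/
def tauCurry (F : ∀ W, K × SphereBundle p q V W → E.obj W) (hF : ∀ W, Continuous (F W))
    (hnat : ∀ k (W W' : Rep) (g : W →ₗᵢ[ℝ] W') z, F W' (k, z.post g) = E.map g (F W (k, z))) :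
    C(K, (tau p q E).obj V) where
  toFun k := ⟨⟨fun W => ⟨fun z => F W (k, z), (hF W).comp (by fun_prop)⟩, hnat k⟩⟩
  continuous_toFun := by
    have hc : Continuous fun k : ULift.{u} K => (⟨fun W => ⟨fun z => F W (k.down, z),
        (hF W).comp (by fun_prop)⟩, hnat k.down⟩ : NatTransf p q E V) := by
      refine Continuous.subtype_mk (continuous_pi fun W => ?_) _
      refine ContinuousMap.continuous_of_continuous_uncurry _ ?_
      exact (hF W).comp (f := fun y : ULift.{u} K × SphereBundle p q V W => (y.1.down, y.2))
        (by fun_prop)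
    exact (Kify.continuous_mk_comp_compact hc).comp continuous_uliftUp

/-- The points fixed by `σ` if `φ` holds, and all points otherwise. This treats both subgroups of
`C₂` at once. -/
def fixedIf (φ : Prop) (Y : C2Space.{u}) : Set Y := {x | φ → Y.sigma x = x}

theorem fixedIf_false (Y : C2Space.{u}) : fixedIf False Y = Set.univ :=
  Set.eq_univ_of_forall fun _ h => h.elim

theorem fixedIf_true (Y : C2Space.{u}) : fixedIf True Y = {x | Y.sigma x = x} :=
  Set.ext fun _ => true_imp_iff

/-- Homotopies of maps from a pair `L ⊆ K` to `ρ_{p,q} E (V)`, in terms of adjoint maps. -/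
theorem pairHomotopic_rho (φ : Prop) {L : Set K} {a₀ a₁ : C(L, E.obj V)}
    {b₀ b₁ : C(K, (tau p q E).obj V)} (h : I × L → E.obj V)
    (H : ∀ W, (I × K) × SphereBundle p q V W → E.obj W) (hc : Continuous h)
    (Hc : ∀ W, Continuous (H W))
    (Hnat : ∀ y (W W' : Rep) (g : W →ₗᵢ[ℝ] W') z, H W' (y, z.post g) = E.map g (H W (y, z)))
    (h0 : ∀ l, h (0, l) = a₀ l) (h1 : ∀ l, h (1, l) = a₁ l)
    (H0 : ∀ k W z, H W ((0, k), z) = tauEval (b₀ k) z)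
    (H1 : ∀ k W z, H W ((1, k), z) = tauEval (b₁ k) z)
    (comp : ∀ t (l : L) W z, H W ((t, (l : K)), z) = E.map z.1.1 (h (t, l)))
    (hfix : φ → ∀ y, (E.obj V).sigma (h y) = h y)
    (Hfix : φ → ∀ y W z, (E.obj W).sigma (H W (y, z.sigma)) = H W (y, z)) :
    PairHomotopic ((rho p q E).app V).toFun (fixedIf φ _) (fixedIf φ _) a₀ a₁ b₀ b₁ := by
  refine ⟨⟨⟨h, hc⟩, h0, h1⟩, ⟨tauCurry H Hc Hnat, fun k => tau_ext fun W z => H0 k W z,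
    fun k => tau_ext fun W z => H1 k W z⟩, fun t l => tau_ext fun W z => comp t l W z,
    fun y hφ => hfix hφ y, fun y hφ => tau_ext fun W z => ?_⟩
  rw [tauEval_sigma]
  exact Hfix hφ y W z

end TauMaps

/-! ### The rotation of the sphere bundle -/

section Rotation

variable {p q : ℕ}

theorem inner_smul_add_smul_eq_zero {A : Type*} [NormedAddCommGroup A] [InnerProductSpace ℝ A]
    {w x y : A} (hx : inner ℝ w x = 0) (hy : inner ℝ w y = 0) (c d : ℝ) :
    inner ℝ w (c • x + d • y) = 0 := by
  rw [inner_add_right, inner_smul_right, inner_smul_right, hx, hy, mul_zero, mul_zero, add_zero]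

theorem norm_smul_add_smul_sq {A : Type*} [NormedAddCommGroup A] [InnerProductSpace ℝ A]
    {x y : A} (h : inner ℝ x y = 0) (c d : ℝ) :
    ‖c • x + d • y‖ ^ 2 = c ^ 2 * ‖x‖ ^ 2 + d ^ 2 * ‖y‖ ^ 2 := by
  rw [norm_add_sq_real, inner_smul_left, inner_smul_right, h, norm_smul, norm_smul, mul_pow,
    mul_pow, Real.norm_eq_abs, Real.norm_eq_abs, sq_abs, sq_abs]
  simp

/-- Given `(f, x)` in `S(V, W)` and `(g, y)` in `S(W, W')`, the vectors `g x` and `y` are orthogonal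
unit vectors in `ℝ^{p,q} ⊗ (g f)(V)^⊥`. The quarter circle from `g x` to `y` gives a path from
`(g f, g x)` to `(g f, y)`. -/
def SphereBundle.rotate {V W W' : Rep} (t : I) (z : SphereBundle p q V W)
    (w : SphereBundle p q W W') : SphereBundle p q V W' :=
  ⟨(w.1.1.comp z.1.1, fun i =>
      Real.cos (t * (Real.pi / 2)) • w.1.1 (z.1.2 i) + Real.sin (t * (Real.pi / 2)) • w.1.2 i), by
    intro i
    rw [mem_range_perp]
    intro v
    have h₁ := mem_range_perp.1 (z.2.1 i) v
    rw [← w.1.1.inner_map_map] at h₁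
    exact inner_smul_add_smul_eq_zero h₁ (mem_range_perp.1 (w.2.1 i) (z.1.1 v)) _ _, by
    have h : ∀ i, ‖Real.cos (t * (Real.pi / 2)) • w.1.1 (z.1.2 i) +
        Real.sin (t * (Real.pi / 2)) • w.1.2 i‖ ^ 2 =
        Real.cos (t * (Real.pi / 2)) ^ 2 * ‖z.1.2 i‖ ^ 2 +
        Real.sin (t * (Real.pi / 2)) ^ 2 * ‖w.1.2 i‖ ^ 2 := by
      intro i
      rw [norm_smul_add_smul_sq (mem_range_perp.1 (w.2.1 i) (z.1.2 i)), LinearIsometry.norm_map]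
    simp only [h]
    rw [Finset.sum_add_distrib, ← Finset.mul_sum, ← Finset.mul_sum, z.2.2, w.2.2, mul_one, mul_one,
      Real.cos_sq_add_sin_sq]⟩

variable {V W W' : Rep}

theorem SphereBundle.continuous_rotate : Continuous
    fun y : (I × SphereBundle p q V W) × SphereBundle p q W W' =>
      SphereBundle.rotate y.1.1 y.1.2 y.2 := by
  have hz : Continuous fun y : (I × SphereBundle p q V W) × SphereBundle p q W W' => y.1.2.1 :=
    continuous_subtype_val.comp (continuous_snd.comp continuous_fst)
  have hw : Continuous fun y : (I × SphereBundle p q V W) × SphereBundle p q W W' => y.2.1 :=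
    continuous_subtype_val.comp continuous_snd
  have hgx : ∀ i, Continuous fun y : (I × SphereBundle p q V W) × SphereBundle p q W W' =>
      y.2.1.1 (y.1.2.1.2 i) := fun i =>
    continuous_isometry_apply.comp ((continuous_fst.comp hw).prodMk
      ((continuous_apply i).comp (continuous_snd.comp hz)))
  have hy : ∀ i, Continuous fun y : (I × SphereBundle p q V W) × SphereBundle p q W W' =>
      y.2.1.2 i := fun i => (continuous_apply i).comp (continuous_snd.comp hw)
  refine Continuous.subtype_mk (Continuous.prodMk (continuous_isometry_comp.comp
    ((continuous_fst.comp hw).prodMk (continuous_fst.comp hz))) (continuous_pi fun i => ?_)) _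
  have ht : Continuous fun y : (I × SphereBundle p q V W) × SphereBundle p q W W' =>
      (y.1.1 : ℝ) * (Real.pi / 2) := by fun_prop
  exact ((Real.continuous_cos.comp ht).smul (hgx i)).add
    ((Real.continuous_sin.comp ht).smul (hy i))

theorem SphereBundle.rotate_zero (z : SphereBundle p q V W) (w : SphereBundle p q W W') :
    SphereBundle.rotate 0 z w = z.post w.1.1 :=
  SphereBundle.ext rfl fun i => by simp [SphereBundle.rotate, SphereBundle.post]

theorem SphereBundle.rotate_one (z : SphereBundle p q V W) (w : SphereBundle p q W W') :
    SphereBundle.rotate 1 z w = w.pre z.1.1 :=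
  SphereBundle.ext rfl fun i => by simp [SphereBundle.rotate, SphereBundle.pre]

theorem SphereBundle.rotate_post {W'' : Rep} (t : I) (z : SphereBundle p q V W)
    (w : SphereBundle p q W W') (h : W' →ₗᵢ[ℝ] W'') :
    SphereBundle.rotate t z (w.post h) = (SphereBundle.rotate t z w).post h :=
  SphereBundle.ext rfl fun i => by simp [SphereBundle.rotate, SphereBundle.post]

theorem SphereBundle.rotate_pre {W'' : Rep} (t : I) (z : SphereBundle p q V W)
    (h : W →ₗᵢ[ℝ] W') (w : SphereBundle p q W' W'') :
    SphereBundle.rotate t (z.post h) w = SphereBundle.rotate t z (w.pre h) :=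
  SphereBundle.ext rfl fun i => by simp [SphereBundle.rotate, SphereBundle.post, SphereBundle.pre]

theorem SphereBundle.rotate_sigma (t : I) (z : SphereBundle p q V W) (w : SphereBundle p q W W') :
    SphereBundle.rotate t z.sigma w.sigma = (SphereBundle.rotate t z w).sigma :=
  SphereBundle.ext (conj_comp _ _).symm (by
    rintro (i | j)
    · simp [SphereBundle.rotate, SphereBundle.sigma]
    · simp [SphereBundle.rotate, SphereBundle.sigma]; abel)

/-- The homotopy `(f, x), (g, y) ↦ α (g f, cos t · g x + sin t · y)` between the two maps
`τ_{p,q}(ρ_{p,q} E)` and `ρ_{p,q}(τ_{p,q} E)` from `τ_{p,q} E` to `τ_{p,q}² E`, applied to a compact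
family of points `α` of `τ_{p,q} E (V)`. -/
def rotateFamily {E : InputFunctor.{u}} {K : Type} [TopologicalSpace K] [CompactSpace K] [T2Space K]
    (b : C(K, (tau p q E).obj V)) (W : Rep) :
    C((I × K) × SphereBundle p q V W, (tau p q E).obj W) :=
  tauCurry (fun _ y => tauEval (b y.1.1.2) (SphereBundle.rotate y.1.1.1 y.1.2 y.2))
    (fun W' => (continuous_tauEval W').comp ((b.continuous.comp (by fun_prop)).prodMk
      (SphereBundle.continuous_rotate.comp
        (((continuous_fst.comp (continuous_fst.comp continuous_fst)).prodMk
          (continuous_snd.comp continuous_fst)).prodMk continuous_snd))))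
    (fun k W W' g z => by rw [SphereBundle.rotate_post, tauEval_post])

theorem tauEval_rotateFamily {E : InputFunctor.{u}} {K : Type} [TopologicalSpace K]
    [CompactSpace K] [T2Space K] (b : C(K, (tau p q E).obj V)) (t : I) (k : K)
    (z : SphereBundle p q V W) (w : SphereBundle p q W W') :
    tauEval (rotateFamily b W ((t, k), z)) w = tauEval (b k) (SphereBundle.rotate t z w) := rfl

end Rotation

/-! ### Lifting along the map from the telescope -/

section Main

variable {p q : ℕ} {V : Rep} {K : Type} [TopologicalSpace K] [CompactSpace K] [T2Space K]

/-- The map that `cylinder` induces on families of natural transformations, by postcomposition. -/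
def tauCylinder {X : ℕ → InputFunctor.{u}} (s : ∀ k, (X k).Hom (X (k + 1))) (N : ℕ) (t : I)
    (b : C(K, (tau p q (X N)).obj V)) : C(K, (tau p q (hocolim s)).obj V) :=
  tauCurry (fun _ y => Telescope.mk s _ ⟨N, (t, tauEval (b y.1) y.2)⟩)
    (fun W => (Telescope.continuous_mk_cylinder W N).comp (continuous_const.prodMk
      ((continuous_tauEval W).comp ((b.continuous.comp continuous_fst).prodMk continuous_snd))))
    (fun k W W' g z => by rw [tauEval_post]; rfl)

/-- The map to the telescope with value in the copy of `X_N` at height `N + t`. -/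
def cylinder {X : ℕ → InputFunctor.{u}} (s : ∀ k, (X k).Hom (X (k + 1))) (N : ℕ) (t : I)
    {L : Type} [TopologicalSpace L] (a : C(L, (X N).obj V)) : C(L, (hocolim s).obj V) :=
  ⟨fun l => Telescope.mk s V ⟨N, (t, a l)⟩, (Telescope.continuous_mk_cylinder V N).comp
    (continuous_const.prodMk a.continuous)⟩

section Sequence

variable {X : ℕ → InputFunctor.{u}} {s : ∀ k, (X k).Hom (X (k + 1))}

/-- A compact family of maps into the telescope has bounded height, so that it can be deformed into
the copy of `X_N` at height `N`, for large `N`. -/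
theorem exists_pairHomotopic_cylinder (φ : Prop) {L : Set K} [CompactSpace L]
    (a : C(L, (hocolim s).obj V)) (b : C(K, (tau p q (hocolim s)).obj V))
    (hab : ∀ l, ((rho p q (hocolim s)).app V).toFun (a l) = b l)
    (ha : ∀ l, a l ∈ fixedIf φ _) (hb : ∀ k, b k ∈ fixedIf φ _) :
    ∃ (N : ℕ) (a₀ : C(L, (X N).obj V)) (b₀ : C(K, (tau p q (X N)).obj V)),
      (∀ l, ((rho p q (X N)).app V).toFun (a₀ l) = b₀ l) ∧
      (∀ l, a₀ l ∈ fixedIf φ _) ∧ (∀ k, b₀ k ∈ fixedIf φ _) ∧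
      PairHomotopic ((rho p q (hocolim s)).app V).toFun (fixedIf φ _) (fixedIf φ _)
        a (cylinder s N 0 a₀) b (tauCylinder s N 0 b₀) := by
  obtain ⟨C, hC⟩ := exists_bound_of_invariant (fun k => (b k).val)
    (Kify.continuous_val.comp b.continuous) (fun W => Telescope.height s W)
    (fun W => Telescope.continuous_height s W) (fun h x => Telescope.height_map h x)
  obtain ⟨C', hC'⟩ := (isCompact_range
    ((Telescope.continuous_height s V).comp a.continuous)).bddAbove
  obtain ⟨N, hN⟩ := exists_nat_ge (max C C')
  have hbN : ∀ k (W : Rep) z, Telescope.height s W (tauEval (b k) z) ≤ N := fun k W z =>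
    (hC k W z).trans ((le_max_left _ _).trans hN)
  have haN : ∀ l, Telescope.height s V (a l) ≤ N := fun l =>
    (hC' ⟨l, rfl⟩).trans ((le_max_right _ _).trans hN)
  have hlt : ∀ {x : ℝ}, x ≤ N → x < N + 1 := fun h => by linarith
  have hab' : ∀ (l : L) W (z : SphereBundle p q V W),
      (hocolim s).map z.1.1 (a l) = tauEval (b l) z := fun l W z => by rw [← hab]; rfl
  have ha' : φ → ∀ l, ((hocolim s).obj V).sigma (a l) = a l := fun h l => ha l h
  have hb' : φ → ∀ k W (z : SphereBundle p q V W),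
      ((hocolim s).obj W).sigma (tauEval (b k) z.sigma) = tauEval (b k) z := fun h k W z =>
    congrArg (fun α => tauEval α z) (hb k h)
  have cb : ∀ W, Continuous fun y : K × SphereBundle p q V W => tauEval (b y.1) y.2 := fun W =>
    (continuous_tauEval W).comp ((b.continuous.comp continuous_fst).prodMk continuous_snd)
  let a₀ : C(L, (X N).obj V) := ⟨fun l => Telescope.retract s V N (a l),
    (Telescope.continuousOn_retract s V N).comp_continuous a.continuous fun l => hlt (haN l)⟩
  let b₀ : C(K, (tau p q (X N)).obj V) :=
    tauCurry (fun W y => Telescope.retract s W N (tauEval (b y.1) y.2))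
      (fun W => (Telescope.continuousOn_retract s W N).comp_continuous (cb W)
        fun y => hlt (hbN _ _ _))
      (fun k W W' g z => by
        rw [tauEval_post]
        exact (Telescope.map_retract g (hbN k W z)).symm)
  refine ⟨N, a₀, b₀, fun l => tau_ext fun W z => ?_, fun l h => ?_,
    fun k h => tau_ext fun W z => ?_,
    pairHomotopic_rho φ (fun y => Telescope.raise s V N y.1 (a y.2))
      (fun W y => Telescope.raise s W N y.1.1 (tauEval (b y.1.2) y.2)) ?_ ?_ ?_ ?_ ?_ ?_ ?_ ?_ ?_ ?_⟩
  · refine (Telescope.map_retract z.1.1 (haN l)).trans ?_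
    rw [hab']
    rfl
  · refine (Telescope.sigma_retract (haN l)).trans ?_
    rw [ha' h]
    rfl
  · refine (Telescope.sigma_retract (hbN k W z.sigma)).trans ?_
    rw [hb' h]
    rfl
  · exact (Telescope.continuous_raise V N).comp (continuous_fst.prodMk
      (a.continuous.comp continuous_snd))
  · exact fun W => (Telescope.continuous_raise W N).comp
      ((continuous_fst.comp continuous_fst).prodMk ((cb W).comp
        ((continuous_snd.comp continuous_fst).prodMk continuous_snd)))
  · intro y W W' g z
    rw [tauEval_post]
    exact (Telescope.map_raise g N _ _).symm
  · exact fun l => Telescope.raise_zero N _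
  · exact fun l => Telescope.raise_one N (haN l)
  · exact fun k W z => Telescope.raise_zero N _
  · exact fun k W z => Telescope.raise_one N (hbN k W z)
  · intro t l W z
    rw [← hab']
    exact (Telescope.map_raise z.1.1 N t _).symm
  · intro h y
    refine (Telescope.sigma_raise N y.1 (a y.2)).trans ?_
    rw [ha' h]
  · intro h y W z
    refine (Telescope.sigma_raise N y.1 _).trans ?_
    rw [hb' h]

/-- The copies of `X_N` and of its image in `X_{N+1}` are joined by the `N`-th cylinder of the
telescope. -/
theorem pairHomotopic_cylinder (φ : Prop) {L : Set K} {N : ℕ}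
    (a : C(L, (X N).obj V)) (b : C(K, (tau p q (X N)).obj V))
    (hab : ∀ l, ((rho p q (X N)).app V).toFun (a l) = b l)
    (ha : ∀ l, a l ∈ fixedIf φ _) (hb : ∀ k, b k ∈ fixedIf φ _) :
    PairHomotopic ((rho p q (hocolim s)).app V).toFun (fixedIf φ _) (fixedIf φ _)
      (cylinder s N 0 a) (cylinder s N 1 a) (tauCylinder s N 0 b) (tauCylinder s N 1 b) := by
  refine pairHomotopic_rho φ (fun y => Telescope.mk s V ⟨N, (y.1, a y.2)⟩)
    (fun W y => Telescope.mk s W ⟨N, (y.1.1, tauEval (b y.1.2) y.2)⟩) ?_ ?_ ?_ (fun _ => rfl)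
    (fun _ => rfl) (fun _ _ _ => rfl) (fun _ _ _ => rfl) ?_ ?_ ?_
  · exact (Telescope.continuous_mk_cylinder V N).comp (continuous_fst.prodMk
      (a.continuous.comp continuous_snd))
  · exact fun W => (Telescope.continuous_mk_cylinder W N).comp
      ((continuous_fst.comp continuous_fst).prodMk ((continuous_tauEval W).comp
        ((b.continuous.comp (continuous_snd.comp continuous_fst)).prodMk continuous_snd)))
  · intro y W W' g z
    rw [tauEval_post]
    rfl
  · intro t l W z
    rw [← hab]
    rfl
  · intro h y
    exact congrArg (fun x => Telescope.mk s V ⟨N, (y.1, x)⟩) (ha y.2 h)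
  · intro h y W z
    exact congrArg (fun α => Telescope.mk s W ⟨N, (y.1, tauEval α z)⟩) (hb y.2 h)

end Sequence

variable {E : InputFunctor.{u}}

/-- The structure maps of the telescope defining `T_{p,q} E`. -/
abbrev tauIterMap (p q : ℕ) (E : InputFunctor.{u}) (k : ℕ) :
    (tauIter p q E k).Hom (tauIter p q E (k + 1)) := rho p q (tauIter p q E k)

/-- At height `N + 1` the map `τ_{p,q}(ρ_{p,q})`, which comes from the cylinders of the telescope,
is rotated into `ρ_{p,q}(τ_{p,q})`, whose values lift to the telescope. On the image of `ρ_{p,q}` the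
rotation is constant, since natural transformations in this image do not depend on the unit
vector. -/
theorem pairHomotopic_rotate (φ : Prop) {L : Set K} {N : ℕ}
    (a : C(L, (tauIter p q E N).obj V)) (b : C(K, (tau p q (tauIter p q E N)).obj V))
    (hab : ∀ l, ((rho p q (tauIter p q E N)).app V).toFun (a l) = b l)
    (hb : ∀ k, b k ∈ fixedIf φ _) :
    PairHomotopic ((rho p q (stronglyPolynomialApprox p q E)).app V).toFun
      (fixedIf φ _) (fixedIf φ _)
      (cylinder (tauIterMap p q E) N 1 a)
      ((cylinder (tauIterMap p q E) (N + 1) 0 b).restrict L)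
      (tauCylinder (tauIterMap p q E) N 1 b)
      (((rho p q (stronglyPolynomialApprox p q E)).app V).toContinuousMap.comp
        (cylinder (tauIterMap p q E) (N + 1) 0 b)) := by
  refine pairHomotopic_rho φ
    (fun y => Telescope.mk (tauIterMap p q E) V ⟨N + 1, (0, b y.2)⟩)
    (fun W y => Telescope.mk (tauIterMap p q E) W ⟨N + 1, (0, rotateFamily b W y)⟩)
    ?_ ?_ ?_ ?_ (fun _ => rfl) ?_ ?_ ?_ ?_ ?_
  · exact (Telescope.continuous_mk_cylinder V (N + 1)).comp (continuous_const.prodMk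
      (b.continuous.comp (continuous_subtype_val.comp continuous_snd)))
  · exact fun W => (Telescope.continuous_mk_cylinder W (N + 1)).comp
      (continuous_const.prodMk (rotateFamily b W).continuous)
  · rintro ⟨t, k⟩ W W' g z
    refine congrArg (fun x => Telescope.mk (tauIterMap p q E) W' ⟨N + 1, (0, x)⟩)
      (tau_ext fun W'' w => ?_ : rotateFamily b W' ((t, k), z.post g) =
        (tau p q (tauIter p q E N)).map g (rotateFamily b W ((t, k), z)))
    rw [tauEval_map, tauEval_rotateFamily, tauEval_rotateFamily, SphereBundle.rotate_pre]
  · intro l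
    rw [← hab]
    exact (Telescope.glue (tauIterMap p q E) V N (a l)).symm
  · intro k W z
    refine Eq.trans ?_ (Telescope.glue (tauIterMap p q E) W N (tauEval (b k) z)).symm
    refine congrArg (fun x => Telescope.mk (tauIterMap p q E) W ⟨N + 1, (0, x)⟩)
      (tau_ext fun W' w => ?_ : rotateFamily b W ((0, k), z) =
        ((rho p q (tauIter p q E N)).app W).toFun (tauEval (b k) z))
    rw [tauEval_rotateFamily, SphereBundle.rotate_zero, tauEval_rho, tauEval_post]
  · intro k W z
    refine congrArg (fun x => Telescope.mk (tauIterMap p q E) W ⟨N + 1, (0, x)⟩)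
      (tau_ext fun W' w => ?_ : rotateFamily b W ((1, k), z) =
        (tau p q (tauIter p q E N)).map z.1.1 (b k))
    rw [tauEval_rotateFamily, SphereBundle.rotate_one, tauEval_map]
  · intro t l W z
    refine congrArg (fun x => Telescope.mk (tauIterMap p q E) W ⟨N + 1, (0, x)⟩)
      (tau_ext fun W' w => ?_ : rotateFamily b W ((t, (l : K)), z) =
        (tau p q (tauIter p q E N)).map z.1.1 (b l))
    rw [tauEval_rotateFamily, tauEval_map, ← hab]
    rfl
  · intro h y
    exact congrArg (fun x => Telescope.mk (tauIterMap p q E) V ⟨N + 1, (0, x)⟩) (hb y.2 h)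
  · rintro h ⟨t, k⟩ W z
    refine congrArg (fun x => Telescope.mk (tauIterMap p q E) W ⟨N + 1, (0, x)⟩)
      (tau_ext fun W' w => ?_ : ((tau p q (tauIter p q E N)).obj W).sigma
        (rotateFamily b W ((t, k), z.sigma)) = rotateFamily b W ((t, k), z))
    rw [tauEval_sigma, tauEval_rotateFamily, tauEval_rotateFamily, SphereBundle.rotate_sigma,
      ← tauEval_sigma]
    exact congrArg (fun α => tauEval α _) (hb k h)

/-- Maps of pairs `∂Iⁿ ⊆ Iⁿ` lift along `ρ_{p,q}(T_{p,q} E)(V)`, and along its restriction to fixed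
points: a family of natural transformations that lies in `τ_{p,q} X_N = X_{N+1}` is already a family
of points of the telescope. -/
theorem liftsCubes_rho (φ : Prop) (E : InputFunctor.{u}) (V : Rep) :
    LiftsCubes ((rho p q (stronglyPolynomialApprox p q E)).app V).toContinuousMap
      (fixedIf φ _) (fixedIf φ _) := by
  intro n a b hab ha hb
  have : CompactSpace (Cube.boundary (Fin n)) := by
    refine isCompact_iff_compactSpace.1 (IsClosed.isCompact ?_)
    rw [show Cube.boundary (Fin n) = ⋃ i, {y : I^ Fin n | y i = 0 ∨ y i = 1} by
      ext y; simp [Cube.boundary]]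
    exact isClosed_iUnion_of_finite fun i => (isClosed_eq (by fun_prop) continuous_const).union
      (isClosed_eq (by fun_prop) continuous_const)
  obtain ⟨N, a₀, b₀, h₀, ha₀, hb₀, H⟩ := exists_pairHomotopic_cylinder φ a b hab ha hb
  exact ⟨cylinder (tauIterMap p q E) (N + 1) 0 b₀,
    fun k h => congrArg (fun x => Telescope.mk (tauIterMap p q E) V ⟨N + 1, (0, x)⟩) (hb₀ k h),
    H.trans ((pairHomotopic_cylinder φ a₀ b₀ h₀ ha₀ hb₀).trans
      (pairHomotopic_rotate φ a₀ b₀ h₀ hb₀))⟩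

end Main

end

end C2Calculus

/-- For every functor `E` of the input category and all `p, q ≥ 0`, the functor
`T_{p,q} E = hocolim_k τ_{p,q}^k E` is strongly `(p, q)`-polynomial. -/
theorem theorem3p12 (E : C2Calculus.InputFunctor.{u}) (p q : ℕ) :
    C2Calculus.IsStronglyPolynomial p q (C2Calculus.stronglyPolynomialApprox p q E) := by
  intro V
  constructor
  · have h := C2Calculus.liftsCubes_rho (p := p) (q := q) False E V
    rw [C2Calculus.fixedIf_false, C2Calculus.fixedIf_false] at h
    exact h.isWeakHomotopyEquiv
  · have h := C2Calculus.liftsCubes_rho (p := p) (q := q) True E V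
    rw [C2Calculus.fixedIf_true, C2Calculus.fixedIf_true] at h
    exact (h.restrict ((C2Calculus.rho p q (C2Calculus.stronglyPolynomialApprox p q E)).app
      V).fixedPoints fun _ => rfl).isWeakHomotopyEquiv
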